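/- Let $n,l,k$ be positive integers with $l/k<1/n$ and let $\beta\in\mathbb R$; throughout, $1/\Gamma$ is taken to be $0$ at the poles of $\Gamma$. For $x\in\mathbb R$ let $$F^{(n)}_{l/k,\beta}(-x)=\sum_{r=0}^\infty\frac{(-x)^r}{[\Gamma(\beta+\frac lk r)]^n}$$ be the Mittag-Leffler function of Le Roy type. Write $\Delta(r,\lambda)$ for the list $\frac{\lambda}{r},\frac{\lambda+1}{r},\dots,\frac{\lambda+r-1}{r}$, and for $y>0$ put $$m_{l/k,\beta}(n;y)=(2\pi)^{\frac{1-k}{2}-\frac{n(1-l)}{2}}\,\frac{k^{3/2}}{l^{\,n(\beta-1/2)}}\,\frac1y\;G^{k,0}_{nl,k}\!\left(\frac{l^{nl}y^k}{k^k}\;\middle|\;{\overbrace{\Delta(l,\beta),\dots,\Delta(l,\beta)}^{n\text{ times}}\atop \Delta(k,1)}\right),$$ where the Meijer function $G^{k,0}_{nl,k}$ with upper parameters $a_1,\dots,a_{nl}$ and lower parameters $b_1,\dots,b_k$ is given for $z>0$ by the Mellin–Barnes integral $$G^{k,0}_{nl,k}\!\left(z\;\middle|\;{(a_i)\atop(b_j)}\right)=\frac1{2\pi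 i}\int_{\operatorname{Re}s=c}z^{-s}\,\frac{\prod_{j=1}^{k}\Gamma(b_j+s)}{\prod_{i=1}^{nl}\Gamma(a_i+s)}\,ds$$ along a vertical line to the right of all poles of the $\Gamma(b_j+s)$. For the parameters above this integral converges absolutely on every such line, and its value does not depend on the line. Moreover: 1. For every $x\in\mathbb R$ the series for $F^{(n)}_{l/k,\beta}(-x)$ converges, the function $y\mapsto e^{-xy}m_{l/k,\beta}(n;y)$ is integrable on $(0,\infty)$, and $$F^{(n)}_{l/k,\beta}(-x)=\int_0^\infty e^{-xy}\,m_{l/k,\beta}(n;y)\,dy.$$ 2. The power series $\sum_{r\ge0}c_ry^r$ with $c_r=\dfrac{(-1)^r}{r!\,[\Gamma(\beta-\frac lk(1+r))]^n}$ has infinite radius of convergence, and $m_{l/k,\beta}(n;y)=\sum_{r\ge0}c_ry^r$ for every $y>0$. 3. There are constants $A,a$ (depending on $n,l,k,\beta$) such that $|m_{l/k,\beta}(n;y)|\le A\,e^{ay}$ for all $y>0$. -/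

import Mathlib

noncomputable section

/-- The Mittag-Leffler function of Le Roy type
`F_{α,β}^{(n)}(x) = ∑ x ^ r / Γ(β + α r) ^ n` at a real point.  At a pole of `Γ` Mathlib's
`Real.Gamma` is `0`, so the term vanishes there, in accordance with `1 / Γ = 0` at the poles. -/
def mittagLefflerLeRoy (n : ℕ) (α β x : ℝ) : ℝ :=
  ∑' r : ℕ, x ^ r / Real.Gamma (β + α * r) ^ n

/-- The list `Δ(r, t) = [t / r, (t + 1) / r, …, (t + r - 1) / r]`. -/
def gammaList (r : ℕ) (t : ℂ) : List ℂ :=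
  (List.range r).map fun i => (t + i) / r

/-- The Mellin-Barnes kernel of `G^{m,n}_{p,q}` with upper parameters `a` (of length `p`) and lower
parameters `b` (of length `q`):
`∏_{j ≤ m} Γ(b_j + s) ∏_{i ≤ n} Γ(1 - a_i - s) / (∏_{i > n} Γ(a_i + s) ∏_{j > m} Γ(1 - b_j - s))`.
As `Complex.Gamma` is `0` at its poles, a pole in the denominator gives the value `0`. -/
def meijerKernel (m n : ℕ) (a b : List ℂ) (s : ℂ) : ℂ :=
  (((b.take m).map fun t => Complex.Gamma (t + s)).prod *
      ((a.take n).map fun t => Complex.Gamma (1 - t - s)).prod) /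
    (((a.drop n).map fun t => Complex.Gamma (t + s)).prod *
      ((b.drop m).map fun t => Complex.Gamma (1 - t - s)).prod)

/-- The vertical line `Re s = c` has all the poles of `Γ(b_j + s)`, `j ≤ m`, on its left and all the
poles of `Γ(1 - a_i - s)`, `i ≤ n`, on its right. -/
def SeparatesPoles (m n : ℕ) (a b : List ℂ) (c : ℝ) : Prop :=
  (∀ t ∈ b.take m, -t.re < c) ∧ ∀ t ∈ a.take n, c < 1 - t.re

/-- The Meijer function `G^{m,n}_{p,q}(z | a ; b)` at a real argument `z > 0`, as the Mellin-Barnes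
integral `(2πi)⁻¹ ∫ z ^ (-s) * meijerKernel m n a b s ds` along a vertical line that separates the
poles.  This is the standard contour when such a line exists and the integral converges absolutely
on it (always the case for `n = 0`, `p < m = q`); the value does not depend on the line. -/
def meijerG (m n : ℕ) (a b : List ℂ) (z : ℝ) : ℂ :=
  mellinInv (Classical.epsilon fun c : ℝ => SeparatesPoles m n a b c) (meijerKernel m n a b) z

/-- The upper parameters of the weight: `Δ(l, β)` repeated `n` times. -/
def upperParams (n l : ℕ) (β : ℝ) : List ℂ :=
  (List.replicate n (gammaList l (β : ℂ))).flatten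

/-- The lower parameters of the weight: `Δ(k, 1)`. -/
def lowerParams (k : ℕ) : List ℂ := gammaList k 1

/-- The weight function
`m_{l/k,β}(n; y) = (2π)^{(1-k)/2 - n(1-l)/2} k^{3/2} l^{-n(β-1/2)} y⁻¹
  G^{k,0}_{nl,k}(l^{nl} y^k / k^k | Δ(l,β), …, Δ(l,β) ; Δ(k,1))`, for `y > 0`. -/
def leRoyWeight (n l k : ℕ) (β y : ℝ) : ℂ :=
  (((2 * Real.pi) ^ ((1 - (k : ℝ)) / 2 - (n : ℝ) * (1 - (l : ℝ)) / 2) * (k : ℝ) ^ (3 / 2 : ℝ) *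
      (l : ℝ) ^ (-((n : ℝ) * (β - 1 / 2))) * y⁻¹ : ℝ) : ℂ) *
    meijerG k 0 (upperParams n l β) (lowerParams k) ((l : ℝ) ^ (n * l) * y ^ k / (k : ℝ) ^ k)

/-- The coefficients `c_r = (-1)^r / (r! Γ(β - (l/k)(1 + r))^n)`, with `1 / Γ = 0` at the poles. -/
def leRoyCoeff (n l k : ℕ) (β : ℝ) (r : ℕ) : ℝ :=
  (-1) ^ r / ((r.factorial : ℝ) * Real.Gamma (β - (l : ℝ) / k * (1 + r)) ^ n)

end

/-!
Put `α = l / k`, so that `n α < 1`.  The weight is the inverse Mellin transform of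
`Γ(s) / Γ(β + α (s - 1)) ^ n`: after the substitution `s ↦ k s + 1`, Gauss' multiplication formula
collapses the products of Gamma functions in the Meijer kernel to this quotient, up to a constant
and a power that rescales the argument.

On vertical lines `Γ` decays like `exp (-π |t| / 2)`, while `1 / Γ(β + α (s - 1)) ^ n` grows at most
like `exp ((n α π / 2 + ε) |t|)`, so `n α < 1` makes the inverse Mellin integral absolutely
convergent.  Moving the line to `-∞` across the poles of `Γ` collects the residues
`(-1) ^ r / (r! Γ(β - α (1 + r)) ^ n) y ^ r`, which are the terms of the power series.  Moving it to
the right through the integers `N` bounds `y ^ N |m(y)|`, and summing these bounds against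
`X ^ N / N!` shows that `m` decays faster than every exponential.  By Mellin inversion the moments
of `m` are `r! / Γ(β + α r) ^ n`; expanding `exp (-x y)` and integrating term by term gives the
Laplace representation.
-/

section RealGamma

open Filter MeasureTheory Set
open Real (Gamma Gamma_pos_of_pos)

/-! ### Growth of the real Gamma function -/

lemma Gamma_one_add_le_rpow {p q : ℝ} (hp : 0 < p) (hq : 0 < q) :
    Gamma (1 + p) ≤ Gamma (1 + (p + q)) ^ (p / (p + q)) := by
  have h := Real.Gamma_mul_add_mul_le_rpow_Gamma_mul_rpow_Gamma (s := 1 + (p + q)) (t := 1)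
    (a := p / (p + q)) (b := q / (p + q)) (by positivity) one_pos (by positivity)
    (by positivity) (by field_simp)
  rw [Real.Gamma_one, Real.one_rpow, mul_one, mul_one] at h
  convert h using 2
  field_simp
  ring

lemma Gamma_one_add_mul_Gamma_one_add_le {u w : ℝ} (hu : 0 ≤ u) (hw : 0 ≤ w) :
    Gamma (1 + u) * Gamma (1 + w) ≤ Gamma (1 + (u + w)) := by
  rcases hu.eq_or_lt with rfl | hu
  · simp
  rcases hw.eq_or_lt with rfl | hw
  · simp
  have hG : 0 < Gamma (1 + (u + w)) := Gamma_pos_of_pos (by positivity)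
  have : 0 ≤ Gamma (1 + w) := (Gamma_pos_of_pos (by positivity)).le
  calc Gamma (1 + u) * Gamma (1 + w)
      ≤ Gamma (1 + (u + w)) ^ (u / (u + w)) * Gamma (1 + (u + w)) ^ (w / (u + w)) := by
        gcongr
        · exact Gamma_one_add_le_rpow hu hw
        · simpa only [add_comm w u] using Gamma_one_add_le_rpow hw hu
    _ = Gamma (1 + (u + w)) := by
        rw [← Real.rpow_add hG, ← add_div, div_self (by positivity), Real.rpow_one]

lemma Gamma_one_add_pow_le {u : ℝ} (hu : 0 ≤ u) (n : ℕ) :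
    Gamma (1 + u) ^ n ≤ Gamma (1 + n * u) := by
  induction n with
  | zero => simp
  | succ n ih =>
    have : 0 ≤ Gamma (1 + u) := (Gamma_pos_of_pos (by positivity)).le
    calc Gamma (1 + u) ^ (n + 1) ≤ Gamma (1 + n * u) * Gamma (1 + u) := by
          rw [pow_succ]; gcongr
      _ ≤ Gamma (1 + (n * u + u)) := Gamma_one_add_mul_Gamma_one_add_le (by positivity) hu
      _ = Gamma (1 + (n + 1 : ℕ) * u) := by push_cast; ring_nf

lemma rpow_mul_exp_neg_le_Gamma {D x : ℝ} (hD : 0 < D) (hx : 1 ≤ x) :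
    D ^ (x - 1) * Real.exp (-(D + 1)) ≤ Gamma x := by
  have hint := Real.GammaIntegral_convergent (s := x) (by linarith)
  have hsub : Ioc D (D + 1) ⊆ Ioi 0 := fun t ht => hD.trans ht.1
  calc D ^ (x - 1) * Real.exp (-(D + 1))
      = ∫ _ in Ioc D (D + 1), D ^ (x - 1) * Real.exp (-(D + 1)) := by simp
    _ ≤ ∫ t in Ioc D (D + 1), Real.exp (-t) * t ^ (x - 1) := by
        refine setIntegral_mono_on (integrableOn_const (by simp)) (hint.mono_set hsub)
          measurableSet_Ioc fun t ht => ?_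
        rw [mul_comm]
        gcongr
        exacts [ht.2, ht.1.le]
    _ ≤ ∫ t in Ioi 0, Real.exp (-t) * t ^ (x - 1) :=
        setIntegral_mono_set hint
          ((ae_restrict_mem measurableSet_Ioi).mono fun t (ht : 0 < t) => by
            simp only [Pi.zero_apply]; positivity)
          hsub.eventuallyLE
    _ = Gamma x := (Real.Gamma_eq_integral (by linarith)).symm

lemma eventually_le_add_mul_natCast {α : ℝ} (hα : 0 < α) (β B : ℝ) :
    ∀ᶠ r : ℕ in atTop, B ≤ β + α * r :=
  (tendsto_atTop_add_const_left _ β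
    (tendsto_natCast_atTop_atTop.const_mul_atTop hα)).eventually_ge_atTop B

lemma exists_mul_pow_le_Gamma_pow {n : ℕ} (hn : 0 < n) {α : ℝ} (hα : 0 < α) (β : ℝ) {A : ℝ}
    (hA : 0 < A) :
    ∃ c > 0, ∀ r : ℕ, 1 ≤ β + α * r → c * A ^ r ≤ Gamma (β + α * r) ^ n := by
  set E : ℝ := A ^ (α * n)⁻¹ with hE
  have hE0 : 0 < E := by positivity
  have hEA : (E ^ α) ^ n = A := by
    rw [← Real.rpow_natCast, ← Real.rpow_mul hE0.le, hE, ← Real.rpow_mul hA.le,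
      inv_mul_cancel₀ (by positivity), Real.rpow_one]
  refine ⟨(E ^ (β - 1) * Real.exp (-(E + 1))) ^ n, by positivity, fun r hr => ?_⟩
  have hE_le : E ^ (β - 1) * Real.exp (-(E + 1)) * (E ^ α) ^ r ≤ Gamma (β + α * r) := by
    convert rpow_mul_exp_neg_le_Gamma hE0 hr using 1
    rw [← Real.rpow_natCast, ← Real.rpow_mul hE0.le, mul_right_comm, ← Real.rpow_add hE0]
    ring_nf
  calc (E ^ (β - 1) * Real.exp (-(E + 1))) ^ n * A ^ r
      = (E ^ (β - 1) * Real.exp (-(E + 1)) * (E ^ α) ^ r) ^ n := by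
        rw [← hEA, mul_pow _ ((E ^ α) ^ r), pow_right_comm]
    _ ≤ Gamma (β + α * r) ^ n := by gcongr

lemma summable_pow_div_Gamma_pow {n : ℕ} (hn : 0 < n) {α : ℝ} (hα : 0 < α) (β D : ℝ) :
    Summable fun r : ℕ => D ^ r / Gamma (β + α * r) ^ n := by
  set A : ℝ := |D| + 1
  have hA : 0 < A := by positivity
  have hDA : |D| / A < 1 := (div_lt_one hA).2 (lt_add_one _)
  obtain ⟨c, hc, hc_le⟩ := exists_mul_pow_le_Gamma_pow hn hα β hA
  refine Summable.of_norm_bounded_eventually_nat (g := fun r : ℕ => c⁻¹ * (|D| / A) ^ r)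
    ((summable_geometric_of_lt_one (by positivity) hDA).mul_left _) ?_
  filter_upwards [eventually_le_add_mul_natCast hα β 1] with r hr
  have hG : 0 < Gamma (β + α * r) := Gamma_pos_of_pos (by linarith)
  calc ‖D ^ r / Gamma (β + α * r) ^ n‖ = |D| ^ r / Gamma (β + α * r) ^ n := by
        rw [norm_div, norm_pow, norm_pow, Real.norm_eq_abs, Real.norm_of_nonneg hG.le]
    _ ≤ |D| ^ r / (c * A ^ r) := by gcongr; exact hc_le r hr
    _ = c⁻¹ * (|D| / A) ^ r := by rw [div_pow]; field_simp

lemma summable_Gamma_pow_mul_pow_div_Gamma {n : ℕ} {α : ℝ} (hα : 0 < α) (hnα : n * α < 1)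
    (q p D : ℝ) : Summable fun r : ℕ => Gamma (q + α * r) ^ n * D ^ r / Gamma (p + r) := by
  have hnα' : 0 < 1 - n * α := by linarith
  refine Summable.of_norm_bounded_eventually_nat
    (summable_pow_div_Gamma_pow one_pos hnα' (p - n * (q - 1)) |D|) ?_
  filter_upwards [eventually_le_add_mul_natCast hα q 1,
    eventually_le_add_mul_natCast hnα' (p - n * (q - 1)) 1] with r hr hr'
  obtain ⟨u, hu, hqu⟩ : ∃ u, 0 ≤ u ∧ q + α * r = 1 + u :=
    ⟨q + α * r - 1, by linarith, by ring⟩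
  obtain ⟨w, hw, hpw⟩ : ∃ w, 0 ≤ w ∧ p - n * (q - 1) + (1 - n * α) * r = 1 + w :=
    ⟨p - n * (q - 1) + (1 - n * α) * r - 1, by linarith, by ring⟩
  have hp : p + r = 1 + (n * u + w) := by linear_combination hpw + n * hqu
  have hGu : 0 < Gamma (1 + u) := Gamma_pos_of_pos (by positivity)
  have hGw : 0 < Gamma (1 + w) := Gamma_pos_of_pos (by positivity)
  have hGp : 0 < Gamma (1 + (n * u + w)) := Gamma_pos_of_pos (by positivity)
  rw [hqu, hpw, hp, pow_one, norm_div, norm_mul, norm_pow, norm_pow, Real.norm_of_nonneg hGu.le,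
    Real.norm_of_nonneg hGp.le, Real.norm_eq_abs, div_le_div_iff₀ hGp hGw]
  calc Gamma (1 + u) ^ n * |D| ^ r * Gamma (1 + w)
      ≤ Gamma (1 + n * u) * |D| ^ r * Gamma (1 + w) := by
        gcongr; exact Gamma_one_add_pow_le hu n
    _ = |D| ^ r * (Gamma (1 + n * u) * Gamma (1 + w)) := by ring
    _ ≤ |D| ^ r * Gamma (1 + (n * u + w)) := by
        gcongr; exact Gamma_one_add_mul_Gamma_one_add_le (by positivity) hw

end RealGamma

section ComplexGamma

open Complex Filter MeasureTheory Set
open scoped Real Nat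

/-! ### Bounds for the complex Gamma function on vertical lines -/

lemma norm_betaIntegral_le {u v : ℂ} (hu : 0 < u.re) (hv : 0 < v.re) :
    ‖betaIntegral u v‖ ≤ Real.Gamma u.re * Real.Gamma v.re / Real.Gamma (u.re + v.re) := by
  have hnorm : ∀ x ∈ Ioo (0 : ℝ) 1, ‖(x : ℂ) ^ (u - 1) * (1 - (x : ℂ)) ^ (v - 1)‖
      = x ^ (u.re - 1) * (1 - x) ^ (v.re - 1) := fun x hx => by
    rw [norm_mul, ← ofReal_one, ← ofReal_sub, norm_cpow_eq_rpow_re_of_pos hx.1,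
      norm_cpow_eq_rpow_re_of_pos (sub_pos.2 hx.2), sub_re, sub_re, ofReal_one, one_re]
  have hreal : ((∫ x in 0..1, x ^ (u.re - 1) * (1 - x) ^ (v.re - 1) : ℝ) : ℂ)
      = betaIntegral u.re v.re := by
    rw [betaIntegral, ← intervalIntegral.integral_ofReal,
      intervalIntegral.integral_of_le zero_le_one, intervalIntegral.integral_of_le zero_le_one]
    refine setIntegral_congr_fun measurableSet_Ioc fun x hx => ?_
    simp only [ofReal_mul, ofReal_cpow hx.1.le, ofReal_cpow (sub_nonneg.2 hx.2), ofReal_sub,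
      ofReal_one]
  calc ‖betaIntegral u v‖
      ≤ ∫ x in (0 : ℝ)..1, ‖(x : ℂ) ^ (u - 1) * (1 - (x : ℂ)) ^ (v - 1)‖ :=
        intervalIntegral.norm_integral_le_integral_norm zero_le_one
    _ = ∫ x in 0..1, x ^ (u.re - 1) * (1 - x) ^ (v.re - 1) := by
        simp only [intervalIntegral.integral_of_le zero_le_one, integral_Ioc_eq_integral_Ioo]
        exact setIntegral_congr_fun measurableSet_Ioo hnorm
    _ = Real.Gamma u.re * Real.Gamma v.re / Real.Gamma (u.re + v.re) := by
        rw [← ofReal_inj, hreal, betaIntegral_eq_Gamma_mul_div _ _ (by simpa) (by simpa)]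
        push_cast [← Gamma_ofReal]
        rfl

lemma Gamma_mul_norm_Gamma_le {a x : ℝ} (ha : 0 < a) (hax : a ≤ x) (t : ℝ) :
    Real.Gamma x * ‖Gamma (a + t * I)‖ ≤ Real.Gamma a * ‖Gamma (x + t * I)‖ := by
  rcases hax.eq_or_lt with rfl | hax
  · rfl
  have hΓx : 0 < Real.Gamma x := Real.Gamma_pos_of_pos (ha.trans hax)
  have hΓd : 0 < Real.Gamma (x - a) := Real.Gamma_pos_of_pos (sub_pos.2 hax)
  have hu : 0 < (a + t * I : ℂ).re := by simpa
  have hv : 0 < ((x - a : ℝ) : ℂ).re := by simpa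
  have hβ : ‖betaIntegral (a + t * I) (x - a : ℝ)‖
      ≤ Real.Gamma a * Real.Gamma (x - a) / Real.Gamma x := by
    simpa using norm_betaIntegral_le hu hv
  have hΓΓ : ‖Gamma (a + t * I)‖ * Real.Gamma (x - a)
      = ‖Gamma (x + t * I)‖ * ‖betaIntegral (a + t * I) (x - a : ℝ)‖ := by
    rw [← norm_mul, show (x + t * I : ℂ) = a + t * I + (x - a : ℝ) by push_cast; ring,
      ← Gamma_mul_Gamma_eq_betaIntegral hu hv, norm_mul, Gamma_ofReal,
      norm_real, Real.norm_of_nonneg hΓd.le]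
  rw [le_div_iff₀ hΓx] at hβ
  refine le_of_mul_le_mul_right ?_ hΓd
  calc Real.Gamma x * ‖Gamma (a + t * I)‖ * Real.Gamma (x - a)
      = ‖Gamma (x + t * I)‖ * (‖betaIntegral (a + t * I) (x - a : ℝ)‖ * Real.Gamma x) := by
        rw [mul_assoc, hΓΓ]; ring
    _ ≤ ‖Gamma (x + t * I)‖ * (Real.Gamma a * Real.Gamma (x - a)) := by gcongr
    _ = Real.Gamma a * ‖Gamma (x + t * I)‖ * Real.Gamma (x - a) := by ring

lemma sq_norm_Gamma_half_add_mul_I (t : ℝ) :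
    ‖Gamma ((1 / 2 : ℝ) + t * I)‖ ^ 2 = π / Real.cosh (π * t) := by
  have hconj : 1 - ((1 / 2 : ℝ) + t * I : ℂ) = starRingEnd ℂ ((1 / 2 : ℝ) + t * I) := by
    simp only [map_add, map_mul, conj_ofReal, conj_I]
    push_cast
    ring
  have hsin : sin (π * ((1 / 2 : ℝ) + t * I)) = Real.cosh (π * t) := by
    rw [show (π : ℂ) * ((1 / 2 : ℝ) + t * I) = (π * t : ℝ) * I + π / 2 by push_cast; ring,
      sin_add_pi_div_two, cos_mul_I, ofReal_cosh]
  rw [← ofReal_inj, ofReal_pow, ← mul_conj', ← Gamma_conj, ← hconj, Gamma_mul_Gamma_one_sub, hsin,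
    ofReal_div]

lemma exp_abs_div_two_le_cosh (x : ℝ) : Real.exp |x| / 2 ≤ Real.cosh x := by
  rw [← Real.cosh_abs, Real.cosh_eq]
  have := Real.exp_pos (-|x|)
  linarith

lemma cosh_le_exp_abs (x : ℝ) : Real.cosh x ≤ Real.exp |x| := by
  have h : Real.exp (-|x|) ≤ Real.exp |x| := Real.exp_le_exp.2 (neg_le_self (abs_nonneg x))
  rw [← Real.cosh_abs, Real.cosh_eq]
  linarith

lemma norm_Gamma_half_add_mul_I_le (t : ℝ) :
    ‖Gamma ((1 / 2 : ℝ) + t * I)‖ ≤ √(2 * π) * Real.exp (-(π / 2 * |t|)) := by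
  refine le_of_sq_le_sq ?_ (by positivity)
  have hcosh := exp_abs_div_two_le_cosh (π * t)
  rw [abs_mul, abs_of_pos Real.pi_pos] at hcosh
  calc ‖Gamma ((1 / 2 : ℝ) + t * I)‖ ^ 2 = π / Real.cosh (π * t) := sq_norm_Gamma_half_add_mul_I t
    _ ≤ π / (Real.exp (π * |t|) / 2) := by gcongr
    _ = (√(2 * π) * Real.exp (-(π / 2 * |t|))) ^ 2 := by
        rw [mul_pow, Real.sq_sqrt (by positivity), ← Real.exp_nat_mul,
          show ((2 : ℕ) : ℝ) * -(π / 2 * |t|) = -(π * |t|) by push_cast; ring, Real.exp_neg]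
        ring

lemma le_norm_Gamma_half_add_mul_I (t : ℝ) :
    √π * Real.exp (-(π / 2 * |t|)) ≤ ‖Gamma ((1 / 2 : ℝ) + t * I)‖ := by
  refine le_of_sq_le_sq ?_ (norm_nonneg _)
  have hcosh := cosh_le_exp_abs (π * t)
  rw [abs_mul, abs_of_pos Real.pi_pos] at hcosh
  calc (√π * Real.exp (-(π / 2 * |t|))) ^ 2 = π / Real.exp (π * |t|) := by
        rw [mul_pow, Real.sq_sqrt Real.pi_pos.le, ← Real.exp_nat_mul,
          show ((2 : ℕ) : ℝ) * -(π / 2 * |t|) = -(π * |t|) by push_cast; ring, Real.exp_neg,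
          div_eq_mul_inv]
    _ ≤ π / Real.cosh (π * t) := by gcongr
    _ = ‖Gamma ((1 / 2 : ℝ) + t * I)‖ ^ 2 := (sq_norm_Gamma_half_add_mul_I t).symm

lemma norm_inv_Gamma_le_of_half_le {x : ℝ} (hx : 1 / 2 ≤ x) (t : ℝ) :
    ‖(Gamma (x + t * I))⁻¹‖ ≤ (Real.Gamma x)⁻¹ * Real.exp (π / 2 * |t|) := by
  have : 0 < Real.Gamma x := Real.Gamma_pos_of_pos (by linarith)
  have hcmp := Gamma_mul_norm_Gamma_le one_half_pos hx t
  rw [Real.Gamma_one_half_eq] at hcmp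
  have hle : Real.Gamma x * Real.exp (-(π / 2 * |t|)) ≤ ‖Gamma (x + t * I)‖ := by
    refine le_of_mul_le_mul_left ?_ (Real.sqrt_pos.2 Real.pi_pos)
    calc √π * (Real.Gamma x * Real.exp (-(π / 2 * |t|)))
        = Real.Gamma x * (√π * Real.exp (-(π / 2 * |t|))) := by ring
      _ ≤ Real.Gamma x * ‖Gamma ((1 / 2 : ℝ) + t * I)‖ := by
          gcongr; exact le_norm_Gamma_half_add_mul_I t
      _ ≤ √π * ‖Gamma (x + t * I)‖ := hcmp
  calc ‖(Gamma (x + t * I))⁻¹‖ ≤ (Real.Gamma x * Real.exp (-(π / 2 * |t|)))⁻¹ := by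
        rw [norm_inv]; gcongr
    _ = (Real.Gamma x)⁻¹ * Real.exp (π / 2 * |t|) := by rw [mul_inv, Real.exp_neg, inv_inv]

lemma norm_Gamma_natCast_add_half_le_pow (N : ℕ) (t : ℝ) :
    ‖Gamma ((N + 1 / 2 : ℝ) + t * I)‖ ≤ (N + |t|) ^ N * ‖Gamma ((1 / 2 : ℝ) + t * I)‖ := by
  induction N with
  | zero => simp
  | succ N ih =>
    set z : ℂ := (N + 1 / 2 : ℝ) + t * I
    have hz_re : z.re = N + 1 / 2 := by simp [z]
    have hz : z ≠ 0 := fun h => by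
      rw [h, zero_re] at hz_re
      linarith [N.cast_nonneg (α := ℝ)]
    have hz_norm : ‖z‖ ≤ (N + 1 : ℕ) + |t| := calc
      ‖z‖ ≤ |(N + 1 / 2 : ℝ)| + |t| := by
        refine (norm_add_le _ _).trans_eq ?_
        rw [norm_mul, norm_I, mul_one, norm_real, norm_real, Real.norm_eq_abs, Real.norm_eq_abs]
      _ ≤ (N + 1 : ℕ) + |t| := by
        rw [abs_of_nonneg (by positivity)]
        push_cast
        linarith
    calc ‖Gamma (((N + 1 : ℕ) + 1 / 2 : ℝ) + t * I)‖ = ‖z‖ * ‖Gamma z‖ := by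
          rw [← norm_mul, ← Gamma_add_one z hz]
          congr 2
          simp only [z]
          push_cast
          ring
      _ ≤ ((N + 1 : ℕ) + |t|) *
            (((N + 1 : ℕ) + |t|) ^ N * ‖Gamma ((1 / 2 : ℝ) + t * I)‖) := by
          gcongr
          refine ih.trans ?_
          gcongr
          exact N.le_succ
      _ = ((N + 1 : ℕ) + |t|) ^ (N + 1) * ‖Gamma ((1 / 2 : ℝ) + t * I)‖ := by ring

lemma sqrt_pi_mul_factorial_le (N : ℕ) : √π * N ! ≤ 2 ^ N * Real.Gamma (N + 1 / 2) := by
  induction N with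
  | zero => simp [← Real.Gamma_one_half_eq]
  | succ N ih =>
    have : 0 < Real.Gamma (N + 1 / 2) := Real.Gamma_pos_of_pos (by positivity)
    calc √π * (N + 1)! = (N + 1) * (√π * N !) := by rw [Nat.factorial_succ]; push_cast; ring
      _ ≤ (2 * (N + 1 / 2)) * (2 ^ N * Real.Gamma (N + 1 / 2)) := by
          gcongr
          linarith [N.cast_nonneg (α := ℝ)]
      _ = 2 ^ (N + 1) * Real.Gamma ((N + 1 : ℕ) + 1 / 2) := by
          rw [Nat.cast_succ, add_right_comm, Real.Gamma_add_one (by positivity)]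
          ring

lemma natCast_add_pow_le {ε a : ℝ} (hε : 0 < ε) (ha : 0 ≤ a) (N : ℕ) :
    (N + a) ^ N ≤ N ! * (Real.exp ε / ε) ^ N * Real.exp (ε * a) := by
  have h := Real.pow_div_factorial_le_exp (x := ε * (N + a)) (by positivity) N
  rw [div_le_iff₀ (by positivity), mul_pow, mul_add, Real.exp_add, mul_comm ε (N : ℝ),
    Real.exp_nat_mul] at h
  rw [div_pow, mul_div_assoc', div_mul_eq_mul_div, le_div_iff₀ (by positivity)]
  linarith

lemma norm_Gamma_natCast_add_half_le (N : ℕ) (t : ℝ) {ε : ℝ} (hε : 0 < ε) :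
    ‖Gamma ((N + 1 / 2 : ℝ) + t * I)‖ ≤ √2 * (2 * Real.exp ε / ε) ^ N *
      Real.Gamma (N + 1 / 2) * Real.exp (-((π / 2 - ε) * |t|)) := by
  calc ‖Gamma ((N + 1 / 2 : ℝ) + t * I)‖
      ≤ (N + |t|) ^ N * ‖Gamma ((1 / 2 : ℝ) + t * I)‖ := norm_Gamma_natCast_add_half_le_pow N t
    _ ≤ N ! * (Real.exp ε / ε) ^ N * Real.exp (ε * |t|) *
          (√(2 * π) * Real.exp (-(π / 2 * |t|))) := by
        gcongr
        exacts [natCast_add_pow_le hε (abs_nonneg t) N, norm_Gamma_half_add_mul_I_le t]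
    _ = √2 * (Real.exp ε / ε) ^ N * (√π * N !) *
          (Real.exp (ε * |t|) * Real.exp (-(π / 2 * |t|))) := by
        rw [Real.sqrt_mul zero_le_two]; ring
    _ ≤ √2 * (Real.exp ε / ε) ^ N * (2 ^ N * Real.Gamma (N + 1 / 2)) *
          (Real.exp (ε * |t|) * Real.exp (-(π / 2 * |t|))) := by
        gcongr √2 * (Real.exp ε / ε) ^ N * ?_ * _
        exact sqrt_pi_mul_factorial_le N
    _ = √2 * (2 * Real.exp ε / ε) ^ N * Real.Gamma (N + 1 / 2) *
          Real.exp (-((π / 2 - ε) * |t|)) := by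
        rw [← Real.exp_add, mul_div_assoc 2, mul_pow 2]; ring_nf

lemma norm_Gamma_le {x : ℝ} (hx : 0 < x) (t : ℝ) {ε : ℝ} (hε : 0 < ε) :
    ‖Gamma (x + t * I)‖ ≤ √2 * (2 * Real.exp ε / ε) ^ (x + 1) *
      Real.Gamma x * Real.exp (-((π / 2 - ε) * |t|)) := by
  set N := ⌈x⌉₊
  have hxN : x ≤ N + 1 / 2 := by linarith [Nat.le_ceil x]
  have hΓN : 0 < Real.Gamma (N + 1 / 2) := Real.Gamma_pos_of_pos (by positivity)
  have : 0 < Real.Gamma x := Real.Gamma_pos_of_pos hx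
  have hK : 1 ≤ 2 * Real.exp ε / ε := by
    rw [one_le_div hε]
    linarith [Real.add_one_le_exp ε]
  refine le_of_mul_le_mul_left ?_ hΓN
  calc Real.Gamma (N + 1 / 2) * ‖Gamma (x + t * I)‖
      ≤ Real.Gamma x * ‖Gamma ((N + 1 / 2 : ℝ) + t * I)‖ := Gamma_mul_norm_Gamma_le hx hxN t
    _ ≤ Real.Gamma x * (√2 * (2 * Real.exp ε / ε) ^ (N : ℝ) *
          Real.Gamma (N + 1 / 2) * Real.exp (-((π / 2 - ε) * |t|))) := by
        gcongr
        rw [Real.rpow_natCast]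
        exact norm_Gamma_natCast_add_half_le N t hε
    _ ≤ Real.Gamma x * (√2 * (2 * Real.exp ε / ε) ^ (x + 1) *
          Real.Gamma (N + 1 / 2) * Real.exp (-((π / 2 - ε) * |t|))) := by
        gcongr
        exacts [(Nat.ceil_lt_add_one hx.le).le]
    _ = Real.Gamma (N + 1 / 2) * (√2 * (2 * Real.exp ε / ε) ^ (x + 1) *
          Real.Gamma x * Real.exp (-((π / 2 - ε) * |t|))) := by ring

lemma continuousOn_Gamma_Ioi : ContinuousOn Real.Gamma (Ioi 0) :=
  Real.differentiableOn_Gamma_Ioi.continuousOn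

lemma exists_norm_Gamma_le {A : ℝ} (hA : 0 < A) (B : ℝ) {ε : ℝ} (hε : 0 < ε) :
    ∃ C, 0 ≤ C ∧ ∀ σ ∈ Icc A B, ∀ t : ℝ,
      ‖Gamma (σ + t * I)‖ ≤ C * Real.exp (-((π / 2 - ε) * |t|)) := by
  obtain ⟨M, hM⟩ := isCompact_Icc.exists_bound_of_continuousOn (s := Icc A B)
    (f := fun x => √2 * (2 * Real.exp ε / ε) ^ (x + 1) * Real.Gamma x)
    ((Continuous.continuousOn (by fun_prop (disch := positivity))).mul
      (continuousOn_Gamma_Ioi.mono fun σ hσ => hA.trans_le hσ.1))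
  refine ⟨|M|, abs_nonneg M, fun σ hσ t => ?_⟩
  calc ‖Gamma (σ + t * I)‖ ≤ _ := norm_Gamma_le (hA.trans_le hσ.1) t hε
    _ ≤ |M| * Real.exp (-((π / 2 - ε) * |t|)) := by
        gcongr
        exact (le_abs_self _).trans ((hM σ hσ).trans (le_abs_self M))

lemma norm_sin_le_exp_abs_im (z : ℂ) : ‖sin z‖ ≤ Real.exp |z.im| := by
  rw [sin, norm_div, norm_mul, norm_I, mul_one, Complex.norm_two,
    div_le_iff₀ two_pos]
  refine (norm_sub_le _ _).trans ?_
  rw [norm_exp, norm_exp]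
  have h₁ : (-z * I).re ≤ |z.im| := by simpa using le_abs_self z.im
  have h₂ : (z * I).re ≤ |z.im| := by simpa using neg_le_abs z.im
  linarith [Real.exp_le_exp.2 h₁, Real.exp_le_exp.2 h₂]

lemma inv_Gamma_eq_sin_mul_Gamma_one_sub {z : ℂ} (hz : z.re < 1) :
    (Gamma z)⁻¹ = sin (π * z) * Gamma (1 - z) / π := by
  have hΓ : Gamma (1 - z) ≠ 0 := Gamma_ne_zero_of_re_pos (by simpa using hz)
  have : (π : ℂ) ≠ 0 := ofReal_ne_zero.2 Real.pi_ne_zero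
  have h := congrArg Inv.inv (Gamma_mul_Gamma_one_sub z)
  rw [mul_inv, inv_div] at h
  rw [mul_div_right_comm, ← h, inv_mul_cancel_right₀ hΓ]

lemma norm_inv_Gamma_le_of_re_lt_one {z : ℂ} (hz : z.re < 1) :
    ‖(Gamma z)⁻¹‖ ≤ Real.exp (π * |z.im|) * ‖Gamma (1 - z)‖ / π := by
  have hsin := norm_sin_le_exp_abs_im (π * z)
  rw [im_ofReal_mul, abs_mul, abs_of_pos Real.pi_pos] at hsin
  rw [inv_Gamma_eq_sin_mul_Gamma_one_sub hz, norm_div, norm_mul, norm_real,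
    Real.norm_of_nonneg Real.pi_pos.le]
  gcongr

lemma exists_norm_inv_Gamma_le (A B : ℝ) {ε : ℝ} (hε : 0 < ε) :
    ∃ C, 0 ≤ C ∧ ∀ σ ∈ Icc A B, ∀ t : ℝ,
      ‖(Gamma (σ + t * I))⁻¹‖ ≤ C * Real.exp ((π / 2 + ε) * |t|) := by
  obtain ⟨M, hM⟩ := isCompact_Icc.exists_bound_of_continuousOn (f := fun σ => (Real.Gamma σ)⁻¹)
    ((continuousOn_Gamma_Ioi.mono fun σ (hσ : σ ∈ Icc (1 / 2) B) => one_half_pos.trans_le hσ.1).inv₀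
      fun σ hσ => (Real.Gamma_pos_of_pos (one_half_pos.trans_le hσ.1)).ne')
  obtain ⟨C, hC, hΓ⟩ := exists_norm_Gamma_le one_half_pos (1 - A) hε
  refine ⟨|M| + C / π, by positivity, fun σ hσ t => ?_⟩
  rw [add_mul]
  rcases le_total (1 / 2) σ with hσ' | hσ'
  · calc ‖(Gamma (σ + t * I))⁻¹‖ ≤ (Real.Gamma σ)⁻¹ * Real.exp (π / 2 * |t|) :=
          norm_inv_Gamma_le_of_half_le hσ' t
      _ ≤ |M| * Real.exp ((π / 2 + ε) * |t|) := by
          gcongr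
          · exact (le_abs_self _).trans ((hM σ ⟨hσ', hσ.2⟩).trans (le_abs_self M))
          · linarith
      _ ≤ _ := le_add_of_nonneg_right (by positivity)
  · have hrefl : ‖Gamma (1 - (σ + t * I))‖ ≤ C * Real.exp (-((π / 2 - ε) * |t|)) := by
      have h := hΓ (1 - σ) ⟨by linarith, by linarith [hσ.1]⟩ (-t)
      rw [abs_neg] at h
      convert h using 3
      push_cast
      ring
    calc ‖(Gamma (σ + t * I))⁻¹‖
        ≤ Real.exp (π * |(σ + t * I : ℂ).im|) * ‖Gamma (1 - (σ + t * I))‖ / π :=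
          norm_inv_Gamma_le_of_re_lt_one (by simp; linarith)
      _ ≤ Real.exp (π * |t|) * (C * Real.exp (-((π / 2 - ε) * |t|))) / π := by
          rw [show (σ + t * I : ℂ).im = t by simp]; gcongr
      _ = C / π * (Real.exp (π * |t|) * Real.exp (-((π / 2 - ε) * |t|))) := by ring
      _ = C / π * Real.exp ((π / 2 + ε) * |t|) := by rw [← Real.exp_add]; ring_nf
      _ ≤ _ := le_add_of_nonneg_left (by positivity)

lemma norm_sin_pi_mul_half_sub_natCast_add_mul_I (N : ℕ) (t : ℝ) :
    ‖sin (π * ((1 / 2 - N : ℝ) + t * I))‖ = Real.cosh (π * t) := by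
  rw [show (π : ℂ) * ((1 / 2 - N : ℝ) + t * I) = (π * t : ℝ) * I + π / 2 - N * π by push_cast; ring,
    sin_antiperiodic.sub_nat_mul_eq, sin_add_pi_div_two, cos_mul_I, ← ofReal_cosh, norm_mul,
    norm_pow, norm_neg, norm_one, one_pow, one_mul, norm_real,
    Real.norm_of_nonneg (Real.cosh_pos _).le]

lemma norm_Gamma_half_sub_natCast_le (N : ℕ) (t : ℝ) :
    ‖Gamma ((1 / 2 - N : ℝ) + t * I)‖
      ≤ 2 * π / Real.Gamma (N + 1 / 2) * Real.exp (-(π / 2 * |t|)) := by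
  set z : ℂ := (1 / 2 - N : ℝ) + t * I
  have hz : 1 - z = (N + 1 / 2 : ℝ) + (-t : ℝ) * I := by
    simp only [z]
    push_cast
    ring
  have hΓz : Gamma z = π / sin (π * z) * (Gamma (1 - z))⁻¹ := by
    have hΓ : Gamma (1 - z) ≠ 0 := Gamma_ne_zero_of_re_pos <| by
      have hre : (1 - z).re = N + 1 / 2 := by simpa using congrArg re hz
      rw [hre]
      positivity
    rw [← Gamma_mul_Gamma_one_sub, mul_inv_cancel_right₀ hΓ]
  have hinv : ‖(Gamma (1 - z))⁻¹‖ ≤ (Real.Gamma (N + 1 / 2))⁻¹ * Real.exp (π / 2 * |t|) := by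
    simpa only [hz, abs_neg] using
      norm_inv_Gamma_le_of_half_le (x := N + 1 / 2) (by linarith [N.cast_nonneg (α := ℝ)]) (-t)
  have hcosh := exp_abs_div_two_le_cosh (π * t)
  rw [abs_mul, abs_of_pos Real.pi_pos] at hcosh
  calc ‖Gamma z‖ = π / Real.cosh (π * t) * ‖(Gamma (1 - z))⁻¹‖ := by
        rw [hΓz, norm_mul, norm_div, norm_sin_pi_mul_half_sub_natCast_add_mul_I, norm_real,
          Real.norm_of_nonneg Real.pi_pos.le]
    _ ≤ π / (Real.exp (π * |t|) / 2) *
          ((Real.Gamma (N + 1 / 2))⁻¹ * Real.exp (π / 2 * |t|)) := by gcongr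
    _ = 2 * π / Real.Gamma (N + 1 / 2) * (Real.exp (-(π * |t|)) * Real.exp (π / 2 * |t|)) := by
        rw [Real.exp_neg]; field_simp
    _ = 2 * π / Real.Gamma (N + 1 / 2) * Real.exp (-(π / 2 * |t|)) := by
        rw [← Real.exp_add]; ring_nf

end ComplexGamma

section VerticalLines

open Complex Filter MeasureTheory Set
open scoped Real Topology

/-! ### Integrals along vertical lines -/

lemma integrable_exp_neg_mul_abs {δ : ℝ} (hδ : 0 < δ) :
    Integrable fun t : ℝ => Real.exp (-(δ * |t|)) := by
  have hpos : IntegrableOn (fun t : ℝ => Real.exp (-(δ * |t|))) (Ioi 0) :=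
    (exp_neg_integrableOn_Ioi 0 hδ).congr_fun
      (fun t (ht : 0 < t) => by simp only [neg_mul, abs_of_pos ht]) measurableSet_Ioi
  have hneg : IntegrableOn (fun t : ℝ => Real.exp (-(δ * |t|))) (Iic 0) :=
    (integrableOn_exp_mul_Iic hδ 0).congr_fun
      (fun t (ht : t ≤ 0) => by simp only [abs_of_nonpos ht, mul_neg, neg_neg]) measurableSet_Iic
  rw [← integrableOn_univ, ← Iic_union_Ioi (a := (0 : ℝ))]
  exact hneg.union hpos

lemma integrable_of_norm_le_exp {f : ℝ → ℂ} (hf : Continuous f) {C δ : ℝ} (hδ : 0 < δ)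
    (h : ∀ t, ‖f t‖ ≤ C * Real.exp (-(δ * |t|))) : Integrable f :=
  ((integrable_exp_neg_mul_abs hδ).const_mul C).mono' hf.aestronglyMeasurable
    (Eventually.of_forall h)

lemma continuous_comp_vertical_line {φ : ℂ → ℂ} {S : Set ℝ}
    (hφ : ContinuousOn φ {s | s.re ∈ S}) {σ : ℝ} (hσ : σ ∈ S) :
    Continuous fun t : ℝ => φ (σ + t * I) :=
  hφ.comp_continuous (by fun_prop) fun t => by simpa using hσ

lemma norm_integral_vertical_sub_le {φ : ℂ → ℂ} {a b : ℝ} (hab : a ≤ b)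
    (hφ : DifferentiableOn ℂ φ {s | s.re ∈ Icc a b}) {K T : ℝ}
    (hK : ∀ σ ∈ Icc a b, ∀ t : ℝ, |t| = T → ‖φ (σ + t * I)‖ ≤ K) (hT : 0 ≤ T) :
    ‖∫ t in (-T)..T, (φ (b + t * I) - φ (a + t * I))‖ ≤ 2 * (K * (b - a)) := by
  have hint : ∀ σ ∈ Icc a b,
      IntervalIntegrable (fun t : ℝ => φ (σ + t * I)) volume (-T) T := fun σ hσ =>
    (continuous_comp_vertical_line hφ.continuousOn hσ).intervalIntegrable _ _
  have hrect := integral_boundary_rect_eq_zero_of_differentiableOn φ (a + (-T : ℝ) * I)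
    (b + T * I) (hφ.mono fun s hs => by simpa [uIcc_of_le hab] using hs.1)
  simp only [add_re, ofReal_re, mul_re, ofReal_im, I_re, I_im, mul_zero, sub_zero, add_zero,
    add_im, mul_im, mul_one, zero_add, smul_eq_mul] at hrect
  have hhor : ∀ τ : ℝ, |τ| = T → ‖∫ x in a..b, φ (x + τ * I)‖ ≤ K * (b - a) := fun τ hτ => by
    rw [← abs_of_nonneg (sub_nonneg.2 hab)]
    exact intervalIntegral.norm_integral_le_of_norm_le_const fun x hx =>
      hK x (Ioc_subset_Icc_self (uIoc_of_le hab ▸ hx)) τ hτ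
  have hvert : I * ∫ t in (-T)..T, (φ (b + t * I) - φ (a + t * I)) =
      (∫ x in a..b, φ (x + T * I)) - ∫ x in a..b, φ (x + (-T : ℝ) * I) := by
    rw [intervalIntegral.integral_sub (hint b ⟨hab, le_rfl⟩) (hint a ⟨le_rfl, hab⟩)]
    linear_combination hrect
  rw [← one_mul ‖_‖, ← norm_I, ← norm_mul, hvert]
  linarith [norm_sub_le (∫ x in a..b, φ (x + T * I)) (∫ x in a..b, φ (x + (-T : ℝ) * I)),
    hhor T (abs_of_nonneg hT), hhor (-T) (by rw [abs_neg, abs_of_nonneg hT])]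

lemma integral_vertical_sub_eq_zero {φ : ℂ → ℂ} {a b : ℝ} (hab : a ≤ b)
    (hφ : DifferentiableOn ℂ φ {s | s.re ∈ Icc a b}) {K : ℝ → ℝ} (hK : Tendsto K atTop (𝓝 0))
    (hφK : ∀ σ ∈ Icc a b, ∀ t : ℝ, 1 ≤ |t| → ‖φ (σ + t * I)‖ ≤ K |t|)
    (hint : Integrable fun t : ℝ => φ (b + t * I) - φ (a + t * I)) :
    ∫ t : ℝ, (φ (b + t * I) - φ (a + t * I)) = 0 := by
  have hlim := intervalIntegral_tendsto_integral hint tendsto_neg_atTop_atBot tendsto_id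
  refine tendsto_nhds_unique hlim (squeeze_zero_norm' (a := fun T => 2 * (K T * (b - a))) ?_ ?_)
  · filter_upwards [eventually_ge_atTop 1] with T hT
    exact norm_integral_vertical_sub_le hab hφ
      (fun σ hσ t ht => ht ▸ hφK σ hσ t (ht ▸ hT)) (by linarith)
  · simpa using (hK.mul_const (b - a)).const_mul 2

lemma integral_vertical_eq {φ : ℂ → ℂ} {a b : ℝ} (hab : a ≤ b)
    (hφ : DifferentiableOn ℂ φ {s | s.re ∈ Icc a b}) {C δ : ℝ} (hδ : 0 < δ)
    (hC : ∀ σ ∈ Icc a b, ∀ t : ℝ, ‖φ (σ + t * I)‖ ≤ C * Real.exp (-(δ * |t|))) :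
    ∫ t : ℝ, φ (a + t * I) = ∫ t : ℝ, φ (b + t * I) := by
  have hint : ∀ σ ∈ Icc a b, Integrable fun t : ℝ => φ (σ + t * I) := fun σ hσ =>
    integrable_of_norm_le_exp (continuous_comp_vertical_line hφ.continuousOn hσ) hδ (hC σ hσ)
  have hb := hint b ⟨hab, le_rfl⟩
  have ha := hint a ⟨le_rfl, hab⟩
  have hexp : Tendsto (fun T : ℝ => C * Real.exp (-(δ * T))) atTop (𝓝 0) := by
    simpa using (Real.tendsto_exp_neg_atTop_nhds_zero.comp
      (tendsto_id.const_mul_atTop hδ)).const_mul C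
  have hzero := integral_vertical_sub_eq_zero hab hφ hexp (fun σ hσ t _ => hC σ hσ t) (hb.sub ha)
  rw [integral_sub hb ha, sub_eq_zero] at hzero
  exact hzero.symm

lemma integral_two_mul_div_sq_add_sq {h : ℝ} (hh : 0 < h) :
    ∫ t : ℝ, 2 * h / (h ^ 2 + t ^ 2) = 2 * π := by
  have hscale : (fun t : ℝ => 2 * h / (h ^ 2 + t ^ 2)) =
      fun t => 2 / h * (1 + (h⁻¹ * t) ^ 2)⁻¹ := by
    ext t
    field_simp
  rw [hscale, integral_const_mul, Measure.integral_comp_mul_left (fun t => (1 + t ^ 2)⁻¹),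
    integral_univ_inv_one_add_sq, inv_inv, abs_of_pos hh, smul_eq_mul]
  field_simp

lemma integrable_two_mul_div_sq_add_sq {h : ℝ} (hh : 0 < h) :
    Integrable fun t : ℝ => 2 * h / (h ^ 2 + t ^ 2) :=
  .of_integral_ne_zero <| by
    rw [integral_two_mul_div_sq_add_sq hh]
    positivity

lemma inv_vertical_sub_inv_vertical {h : ℝ} (hh : 0 < h) (t : ℝ) :
    (h + t * I : ℂ)⁻¹ - (-h + t * I : ℂ)⁻¹ = (2 * h / (h ^ 2 + t ^ 2) : ℝ) := by
  have h₁ : (h + t * I : ℂ) ≠ 0 := fun h0 => hh.ne' (by simpa using congrArg re h0)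
  have h₂ : (-h + t * I : ℂ) ≠ 0 := fun h0 => hh.ne' (by simpa using congrArg re h0)
  have h₃ : ((h : ℂ) ^ 2 + t ^ 2) ≠ 0 := mod_cast (by positivity : h ^ 2 + t ^ 2 ≠ 0)
  push_cast
  field_simp
  linear_combination -(2 * (h : ℂ) * t ^ 2) * I_sq

lemma norm_dslope_vertical_le {G : ℂ → ℂ} {p : ℂ} {C δ : ℝ} (hC : 0 ≤ C) (hδ : 0 ≤ δ) {z : ℂ}
    (hz : 1 ≤ |(z - p).im|) (hG : ‖G z‖ ≤ C * Real.exp (-(δ * |(z - p).im|))) :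
    ‖dslope G p z‖ ≤ (C + ‖G p‖) / |(z - p).im| := by
  have hzp : z ≠ p := fun h => by simp [h] at hz; linarith
  have hGz : ‖G z‖ ≤ C := hG.trans <| mul_le_of_le_one_right hC <|
    Real.exp_le_one_iff.2 <| neg_nonpos.2 <| by positivity
  rw [dslope_of_ne _ hzp, slope_def_field, norm_div]
  gcongr
  · exact (norm_sub_le _ _).trans (by gcongr)
  · exact abs_im_le_norm _

lemma integrable_vertical_div {G : ℂ → ℂ} {S : Set ℝ} (hG : ContinuousOn G {s | s.re ∈ S})
    {C δ : ℝ} (hδ : 0 < δ) (hC : ∀ σ ∈ S, ∀ t : ℝ, ‖G (σ + t * I)‖ ≤ C * Real.exp (-(δ * |t|)))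
    {σ u : ℝ} (hσ : σ ∈ S) (hu : u ≠ 0) : Integrable fun t : ℝ => G (σ + t * I) / (u + t * I) := by
  have hne : ∀ t : ℝ, (u + t * I : ℂ) ≠ 0 := fun t h0 => hu (by simpa using congrArg re h0)
  refine integrable_of_norm_le_exp (C := C / |u|)
    ((continuous_comp_vertical_line hG hσ).div (by fun_prop) hne) hδ fun t => ?_
  rw [norm_div, div_mul_eq_mul_div]
  have hre : |u| ≤ ‖(u + t * I : ℂ)‖ := by simpa using abs_re_le_norm (u + t * I : ℂ)
  have hpos : 0 < |u| := abs_pos.2 hu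
  exact div_le_div₀ ((norm_nonneg _).trans (hC σ hσ t)) (hC σ hσ t) hpos hre

lemma dslope_vertical_sub {G : ℂ → ℂ} {p h : ℝ} (hh : 0 < h) (t : ℝ) :
    dslope G p ((p + h : ℝ) + t * I) - dslope G p ((p - h : ℝ) + t * I) =
      G ((p + h : ℝ) + t * I) / (h + t * I) - G ((p - h : ℝ) + t * I) / (-h + t * I) -
        ((2 * h / (h ^ 2 + t ^ 2) : ℝ) : ℂ) * G p := by
  have hdslope : ∀ u : ℝ, u ≠ 0 → dslope G p ((p + u : ℝ) + t * I) =
      (G ((p + u : ℝ) + t * I) - G p) / (u + t * I) := fun u hu => by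
    rw [dslope_of_ne _ fun h0 => hu (by simpa using congrArg re h0), slope_def_field]
    congr 1
    push_cast
    ring
  have hneg := hdslope (-h) (neg_ne_zero.2 hh.ne')
  rw [← sub_eq_add_neg, ofReal_neg] at hneg
  rw [hdslope h hh.ne', hneg, ← inv_vertical_sub_inv_vertical hh]
  ring

lemma integral_vertical_div_sub {G : ℂ → ℂ} {p h : ℝ} (hh : 0 < h)
    (hG : DifferentiableOn ℂ G {s | s.re ∈ Icc (p - h) (p + h)}) {C δ : ℝ} (hδ : 0 < δ)
    (hC : ∀ σ ∈ Icc (p - h) (p + h), ∀ t : ℝ, ‖G (σ + t * I)‖ ≤ C * Real.exp (-(δ * |t|))) :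
    (∫ t : ℝ, G ((p + h : ℝ) + t * I) / (h + t * I)) -
      ∫ t : ℝ, G ((p - h : ℝ) + t * I) / (-h + t * I) = 2 * π * G p := by
  have hp : p - h ≤ p + h := by linarith
  have hstrip : {s : ℂ | s.re ∈ Icc (p - h) (p + h)} ∈ 𝓝 (p : ℂ) :=
    continuous_re.continuousAt.preimage_mem_nhds (Icc_mem_nhds (by simpa) (by simpa))
  have hC0 : 0 ≤ C := by
    simpa using (norm_nonneg _).trans (hC p ⟨by linarith, by linarith⟩ 0)
  have hright : Integrable fun t : ℝ => G ((p + h : ℝ) + t * I) / (h + t * I) :=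
    integrable_vertical_div hG.continuousOn hδ hC ⟨hp, le_rfl⟩ hh.ne'
  have hleft : Integrable fun t : ℝ => G ((p - h : ℝ) + t * I) / (-h + t * I) := by
    simpa using integrable_vertical_div hG.continuousOn hδ hC ⟨le_rfl, hp⟩ (neg_ne_zero.2 hh.ne')
  have hpole : Integrable fun t : ℝ => ((2 * h / (h ^ 2 + t ^ 2) : ℝ) : ℂ) * G p :=
    (integrable_two_mul_div_sq_add_sq hh).ofReal.mul_const _
  have hzero := integral_vertical_sub_eq_zero hp
    ((differentiableOn_dslope hstrip).2 hG) (K := fun T => (C + ‖G p‖) / T)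
    (tendsto_const_nhds.div_atTop tendsto_id)
    (fun σ hσ t ht => by
      simpa using norm_dslope_vertical_le hC0 hδ.le (p := p) (z := σ + t * I)
        (by simpa using ht) (by simpa using hC σ hσ t))
    (by simpa only [dslope_vertical_sub hh] using (hright.sub' hleft).sub' hpole)
  simp_rw [dslope_vertical_sub hh] at hzero
  rw [integral_sub (hright.sub' hleft) hpole, integral_sub hright hleft, integral_mul_const,
    integral_complex_ofReal, integral_two_mul_div_sq_add_sq hh, sub_eq_zero] at hzero
  simpa using hzero

end VerticalLines

section GammaResidues

open Complex Filter MeasureTheory Set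
open scoped Real Topology

lemma differentiableOn_Gamma : DifferentiableOn ℂ Gamma {s | 0 < s.re} :=
  fun s (hs : 0 < s.re) =>
    (differentiableAt_Gamma s fun m hm => by simp [hm] at hs; linarith [m.cast_nonneg (α := ℝ)])
      |>.differentiableWithinAt

lemma integral_vertical_Gamma_mul_sub_zero {f : ℂ → ℂ}
    (hf : DifferentiableOn ℂ f {s | s.re ∈ Icc (-(1 / 2) : ℝ) (1 / 2)}) {C κ : ℝ}
    (hκ : κ < π / 2)
    (hfC : ∀ σ ∈ Icc (-(1 / 2) : ℝ) (1 / 2), ∀ t : ℝ,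
      ‖f (σ + t * I)‖ ≤ C * Real.exp (κ * |t|)) :
    (∫ t : ℝ, Gamma ((1 / 2 : ℝ) + t * I) * f ((1 / 2 : ℝ) + t * I)) -
      ∫ t : ℝ, Gamma ((-(1 / 2) : ℝ) + t * I) * f ((-(1 / 2) : ℝ) + t * I) = 2 * π * f 0 := by
  have hδ : 0 < (π / 2 - κ) / 2 := by linarith
  obtain ⟨M, hM, hΓ⟩ := exists_norm_Gamma_le one_half_pos (3 / 2) hδ
  have hdiff : DifferentiableOn ℂ (fun s => Gamma (s + 1) * f s)
      {s | s.re ∈ Icc (-(1 / 2) : ℝ) (1 / 2)} :=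
    .mul (differentiableOn_Gamma.comp (by fun_prop) fun s hs => by
      have hre : 0 < s.re + 1 := by linarith [hs.1]
      simpa using hre) hf
  have hbound : ∀ σ ∈ Icc (-(1 / 2) : ℝ) (1 / 2), ∀ t : ℝ,
      ‖Gamma (σ + t * I + 1) * f (σ + t * I)‖ ≤
        M * C * Real.exp (-((π / 2 - κ) / 2 * |t|)) := fun σ hσ t => by
    have hΓt := hΓ (σ + 1) ⟨by linarith [hσ.1], by linarith [hσ.2]⟩ t
    rw [show ((σ + 1 : ℝ) : ℂ) + t * I = σ + t * I + 1 by push_cast; ring] at hΓt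
    calc ‖Gamma (σ + t * I + 1) * f (σ + t * I)‖
        ≤ M * Real.exp (-((π / 2 - (π / 2 - κ) / 2) * |t|)) * (C * Real.exp (κ * |t|)) := by
          rw [norm_mul]
          exact mul_le_mul hΓt (hfC σ hσ t) (norm_nonneg _) (by positivity)
      _ = M * C * Real.exp (-((π / 2 - κ) / 2 * |t|)) := by
          rw [mul_mul_mul_comm, ← Real.exp_add]
          ring_nf
  have hcauchy := integral_vertical_div_sub (p := 0) one_half_pos (by simpa using hdiff) hδ
    (by simpa using hbound)
  have hΓdiv : ∀ u : ℝ, u ≠ 0 → ∀ t : ℝ, Gamma (u + t * I + 1) * f (u + t * I) / (u + t * I) =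
      Gamma (u + t * I) * f (u + t * I) := fun u hu t => by
    have hne : (u + t * I : ℂ) ≠ 0 := fun h0 => hu (by simpa using congrArg re h0)
    rw [Gamma_add_one _ hne]
    field_simp
  rw [zero_add, zero_sub, ← ofReal_neg] at hcauchy
  simpa only [hΓdiv (1 / 2) (by norm_num), hΓdiv (-(1 / 2)) (by norm_num), ofReal_zero,
    zero_add, Gamma_one, one_mul]
    using hcauchy

lemma Gamma_mul_div_sub_one {s : ℂ} (hs : s - 1 ≠ 0) (w : ℂ) :
    Gamma s * (w / (s - 1)) = Gamma (s - 1) * w := by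
  rw [← sub_add_cancel s 1, Gamma_add_one _ hs, add_sub_cancel_right]
  field_simp

lemma sub_one_mem_Icc_of_mem_Icc {r : ℕ} {σ : ℝ} (hσ : σ ∈ Icc (-(1 / 2) - r : ℝ) (1 / 2 - r)) :
    σ - 1 ∈ Icc (-(1 / 2) - (r + 1 : ℕ) : ℝ) (1 / 2 - (r + 1 : ℕ)) := by
  push_cast
  exact ⟨by linarith [hσ.1], by linarith [hσ.2]⟩

lemma half_le_norm_sub_one {r : ℕ} {s : ℂ} (hs : s.re ∈ Icc (-(1 / 2) - r : ℝ) (1 / 2 - r)) :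
    1 / 2 ≤ ‖s - 1‖ := by
  refine le_trans ?_ (abs_re_le_norm (s - 1))
  rw [sub_re, one_re, le_abs']
  exact .inl (by linarith [hs.2, r.cast_nonneg (α := ℝ)])

lemma integral_vertical_Gamma_mul_sub (r : ℕ) {f : ℂ → ℂ}
    (hf : DifferentiableOn ℂ f {s | s.re ∈ Icc (-(1 / 2) - r : ℝ) (1 / 2 - r)}) {C κ : ℝ}
    (hκ : κ < π / 2)
    (hfC : ∀ σ ∈ Icc (-(1 / 2) - r : ℝ) (1 / 2 - r), ∀ t : ℝ,
      ‖f (σ + t * I)‖ ≤ C * Real.exp (κ * |t|)) :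
    (∫ t : ℝ, Gamma ((1 / 2 - r : ℝ) + t * I) * f ((1 / 2 - r : ℝ) + t * I)) -
        ∫ t : ℝ, Gamma ((-(1 / 2) - r : ℝ) + t * I) * f ((-(1 / 2) - r : ℝ) + t * I) =
      2 * π * ((-1) ^ r / r.factorial * f (-r)) := by
  induction r generalizing f C with
  | zero =>
    simp only [Nat.cast_zero, sub_zero] at hf hfC ⊢
    simpa only [pow_zero, Nat.factorial_zero, Nat.cast_one, div_one, one_mul, neg_zero]
      using integral_vertical_Gamma_mul_sub_zero hf hκ hfC
  | succ r ih =>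
    have hne : ∀ s : ℂ, s.re ∈ Icc (-(1 / 2) - r : ℝ) (1 / 2 - r) → s - 1 ≠ 0 :=
      fun s hs => norm_pos_iff.1 (one_half_pos.trans_le (half_le_norm_sub_one hs))
    have hshift := ih (f := fun s => f (s - 1) / (s - 1)) (C := C / (1 / 2))
      (.div (hf.comp (by fun_prop) fun s hs => by simpa using sub_one_mem_Icc_of_mem_Icc hs)
        (by fun_prop) hne)
      fun σ hσ t => by
        rw [norm_div, div_mul_eq_mul_div]
        have hft := hfC _ (sub_one_mem_Icc_of_mem_Icc hσ) t
        rw [ofReal_sub, ofReal_one, sub_add_eq_add_sub] at hft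
        exact div_le_div₀ ((norm_nonneg _).trans hft) hft one_half_pos
          (half_le_norm_sub_one (s := σ + t * I) (by simpa using hσ))
    have hΓ : ∀ σ : ℝ, σ ∈ Icc (-(1 / 2) - r : ℝ) (1 / 2 - r) → ∀ t : ℝ,
        Gamma (σ + t * I) * (f (σ + t * I - 1) / (σ + t * I - 1)) =
          Gamma ((σ - 1 : ℝ) + t * I) * f ((σ - 1 : ℝ) + t * I) := fun σ hσ t => by
      rw [Gamma_mul_div_sub_one (hne _ (by simpa using hσ)), ofReal_sub, ofReal_one,
        sub_add_eq_add_sub]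
    simp only [hΓ _ ⟨le_rfl, by linarith⟩, hΓ (1 / 2 - r) ⟨by linarith, le_rfl⟩] at hshift
    rw [Nat.cast_add_one, ← sub_sub, ← sub_sub, hshift, Nat.factorial_succ, Nat.cast_mul, pow_succ,
      Nat.cast_add_one, neg_add']
    have hr : (-r - 1 : ℂ) ≠ 0 := by
      rw [← neg_add', neg_ne_zero]
      exact r.cast_add_one_ne_zero
    rw [← neg_neg (r + 1 : ℂ), neg_add']
    field_simp

end GammaResidues

section GaussMultiplication

open Filter Finset
open scoped Real Topology

/-! ### The Gauss multiplication formula -/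

lemma prod_two_mul_sin (m : ℕ) :
    ∏ j ∈ range m, 2 * Real.sin (π * ((j + 1) / (m + 1))) = m + 1 := by
  have hsin : ∀ j ∈ range m, 0 ≤ Real.sin (π * ((j + 1) / (m + 1))) := fun j hj => by
    refine Real.sin_nonneg_of_nonneg_of_le_pi (by positivity) ?_
    have hjm : (j + 1 : ℝ) ≤ m + 1 := by exact_mod_cast Nat.succ_le_succ (mem_range.1 hj).le
    exact mul_le_of_le_one_right Real.pi_pos.le ((div_le_one (by positivity)).2 hjm)
  have hroot := (Complex.isPrimitiveRoot_exp (m + 1) m.succ_ne_zero).prod_one_sub_pow_eq_order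
  calc ∏ j ∈ range m, 2 * Real.sin (π * ((j + 1) / (m + 1)))
      = ‖∏ j ∈ range m, (1 - Complex.exp (2 * π * Complex.I / (m + 1 : ℕ)) ^ (j + 1))‖ := by
        rw [norm_prod]
        refine prod_congr rfl fun j hj => ?_
        rw [← Complex.exp_nat_mul, norm_sub_rev, show ((j + 1 : ℕ) : ℂ) *
          (2 * π * Complex.I / (m + 1 : ℕ)) =
            Complex.I * (2 * (π * ((j + 1) / (m + 1))) : ℝ) by push_cast; ring,
          Complex.norm_exp_I_mul_ofReal_sub_one, mul_div_cancel_left₀ _ two_ne_zero,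
          Real.norm_of_nonneg (mul_nonneg two_pos.le (hsin j hj))]
    _ = m + 1 := by
        rw [hroot]
        exact_mod_cast Complex.norm_natCast (m + 1)

lemma prod_Gamma_add_one_div_sq (m : ℕ) :
    (∏ j ∈ range m, Real.Gamma ((j + 1) / (m + 1))) ^ 2 = (2 * π) ^ m / (m + 1) := by
  have hreflect : ∏ j ∈ range m, Real.Gamma ((j + 1) / (m + 1)) =
      ∏ j ∈ range m, Real.Gamma (1 - (j + 1) / (m + 1)) := by
    rw [← prod_range_reflect]
    refine prod_congr rfl fun j hj => ?_
    have hm : (m + 1 : ℝ) ≠ 0 := by positivity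
    have hj' : ((m - 1 - j : ℕ) : ℝ) + 1 = m - j := by
      rw [← Nat.cast_add_one, ← Nat.cast_sub (mem_range.1 hj).le]
      congr 1
      have := mem_range.1 hj
      omega
    rw [hj', one_sub_div hm]
    congr 2
    ring
  calc (∏ j ∈ range m, Real.Gamma ((j + 1) / (m + 1))) ^ 2
      = ∏ j ∈ range m, 2 * π / (2 * Real.sin (π * ((j + 1) / (m + 1)))) := by
        rw [pow_two]
        nth_rw 2 [hreflect]
        rw [← prod_mul_distrib]
        exact prod_congr rfl fun j _ => by
          rw [Real.Gamma_mul_Gamma_one_sub, mul_div_mul_left _ _ two_ne_zero]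
    _ = (2 * π) ^ m / (m + 1) := by
        rw [prod_div_distrib, prod_const, card_range, prod_two_mul_sin]

/-- The function `x ↦ k ^ (x - 1) ∏ j < k, Γ((x + j) / k)`, a multiple of `Γ` by the
Bohr–Mollerup theorem. -/
noncomputable def gaussGamma (k : ℕ) (x : ℝ) : ℝ :=
  k ^ (x - 1) * ∏ j ∈ range k, Real.Gamma ((x + j) / k)

variable {k : ℕ}

lemma gaussGamma_pos (hk : 0 < k) {x : ℝ} (hx : 0 < x) : 0 < gaussGamma k x :=
  mul_pos (by positivity) (prod_pos fun j _ => Real.Gamma_pos_of_pos (by positivity))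

lemma gaussGamma_add_one (hk : 0 < k) {x : ℝ} (hx : 0 < x) :
    gaussGamma k (x + 1) = x * gaussGamma k x := by
  have hk' : (0 : ℝ) < k := mod_cast hk
  have hΓ : Real.Gamma (x / k) ≠ 0 := (Real.Gamma_pos_of_pos (by positivity)).ne'
  have hshift : (∏ j ∈ range k, Real.Gamma ((x + 1 + j) / k)) * Real.Gamma (x / k) =
      (∏ j ∈ range k, Real.Gamma ((x + j) / k)) * (x / k * Real.Gamma (x / k)) := by
    have hcycle := (prod_range_succ' (fun j : ℕ => Real.Gamma ((x + j) / k)) k).symm.trans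
      (prod_range_succ (fun j : ℕ => Real.Gamma ((x + j) / k)) k)
    rw [add_div x k, div_self hk'.ne', Real.Gamma_add_one (by positivity)] at hcycle
    simpa only [Nat.cast_add_one, Nat.cast_zero, add_zero, add_assoc, add_comm (1 : ℝ)]
      using hcycle
  rw [← mul_assoc] at hshift
  rw [gaussGamma, gaussGamma, mul_right_cancel₀ hΓ hshift, add_sub_right_comm,
    Real.rpow_add_one hk'.ne']
  field_simp

lemma convexOn_log_gaussGamma (hk : 0 < k) :
    ConvexOn ℝ (Set.Ioi 0) (Real.log ∘ gaussGamma k) := by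
  have hk' : (0 : ℝ) < k := mod_cast hk
  have hΓ : ∀ x : ℝ, 0 < x → ∀ j : ℕ, 0 < Real.Gamma ((x + j) / k) := fun x hx j =>
    Real.Gamma_pos_of_pos (by positivity)
  have hterm : ∀ j : ℕ, ConvexOn ℝ (Set.Ioi (0 : ℝ))
      fun x : ℝ => Real.log (Real.Gamma ((x + j) / k)) := fun j => by
    refine ⟨convex_Ioi 0, fun x (hx : 0 < x) y (hy : 0 < y) a b ha hb hab => ?_⟩
    have hmid : (a • x + b • y + j) / (k : ℝ) = a • ((x + j) / k) + b • ((y + j) / k) := by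
      simp only [smul_eq_mul]
      field_simp
      linear_combination -(j : ℝ) * hab
    simp only [hmid]
    exact Real.convexOn_log_Gamma.2 (show 0 < (x + j) / k by positivity)
      (show 0 < (y + j) / k by positivity) ha hb hab
  have hsum : ConvexOn ℝ (Set.Ioi (0 : ℝ))
      fun x : ℝ => ∑ j ∈ range k, Real.log (Real.Gamma ((x + j) / k)) := by
    have := fun s : Finset ℕ => Finset.sum_induction (s := s)
      (fun (j : ℕ) (x : ℝ) => Real.log (Real.Gamma ((x + j) / k)))
      (ConvexOn ℝ (Set.Ioi 0)) (fun _ _ => ConvexOn.add) (convexOn_const 0 (convex_Ioi 0))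
      fun j _ => hterm j
    simpa only [Finset.sum_fn] using this (range k)
  have hlinear : ConvexOn ℝ (Set.Ioi (0 : ℝ)) fun x : ℝ => Real.log k * x - Real.log k :=
    (((convexOn_id (convex_Ioi 0)).smul (Real.log_natCast_nonneg k)).add_const _)
  refine (hlinear.add hsum).congr fun x (hx : 0 < x) => ?_
  rw [Pi.add_apply, Function.comp_apply, gaussGamma, Real.log_mul (by positivity)
    (prod_pos fun j _ => hΓ x hx j).ne', Real.log_rpow hk',
    Real.log_prod fun j _ => (hΓ x hx j).ne']
  ring

lemma gaussGamma_eq (hk : 0 < k) {x : ℝ} (hx : 0 < x) :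
    gaussGamma k x = gaussGamma k 1 * Real.Gamma x := by
  have hone := gaussGamma_pos hk one_pos
  have hBM : Set.EqOn (fun x => gaussGamma k x / gaussGamma k 1) Real.Gamma (Set.Ioi 0) := by
    refine Real.eq_Gamma_of_log_convex ?_ (fun hy => ?_) (fun hy => ?_) (div_self hone.ne')
    · refine ((convexOn_log_gaussGamma hk).add_const (-Real.log (gaussGamma k 1))).congr
        fun y (hy : 0 < y) => ?_
      simp only [Function.comp_apply, Pi.add_apply]
      rw [Real.log_div (gaussGamma_pos hk hy).ne' hone.ne', sub_eq_add_neg]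
    · rw [gaussGamma_add_one hk hy, mul_div_assoc]
    · exact div_pos (gaussGamma_pos hk hy) hone
  rw [← hBM hx, mul_div_cancel₀ _ hone.ne']

lemma gaussGamma_one (hk : 0 < k) : gaussGamma k 1 = (2 * π) ^ (((k : ℝ) - 1) / 2) / √k := by
  obtain ⟨m, rfl⟩ := Nat.exists_eq_add_one.2 hk
  refine (sq_eq_sq₀ (gaussGamma_pos hk one_pos).le (by positivity)).1 ?_
  have hlast : (1 + m : ℝ) / (m + 1) = 1 := by rw [add_comm, div_self (by positivity)]
  rw [gaussGamma, sub_self, Real.rpow_zero, one_mul, prod_range_succ, Nat.cast_add_one, hlast,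
    Real.Gamma_one, mul_one, div_pow, Real.sq_sqrt (by positivity), ← Real.rpow_mul_natCast
    (by positivity), add_sub_cancel_right, Nat.cast_two, div_mul_cancel₀ _ two_ne_zero,
    Real.rpow_natCast, ← prod_Gamma_add_one_div_sq]
  simp only [add_comm (1 : ℝ)]

lemma prod_Gamma_add_div_of_pos (hk : 0 < k) {x : ℝ} (hx : 0 < x) :
    ∏ j ∈ range k, Real.Gamma (x + j / k) =
      (2 * π) ^ (((k : ℝ) - 1) / 2) * √k * k ^ (-(k * x)) * Real.Gamma (k * x) := by
  have hk' : (0 : ℝ) < k := mod_cast hk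
  have hgauss := gaussGamma_eq hk (x := k * x) (by positivity)
  rw [gaussGamma_one hk, gaussGamma, Real.rpow_sub_one hk'.ne'] at hgauss
  have harg : ∀ j : ℕ, (k * x + j) / k = x + j / k := fun j => by field_simp
  simp only [harg] at hgauss
  rw [Real.rpow_neg hk'.le]
  have hsqrt : √(k : ℝ) * √k = k := Real.mul_self_sqrt hk'.le
  have := Real.rpow_pos_of_pos hk' (k * x)
  field_simp at hgauss ⊢
  refine mul_right_cancel₀ (Real.sqrt_pos.2 hk').ne' ?_
  linear_combination hgauss - (2 * π) ^ (((k : ℝ) - 1) / 2) * Real.Gamma (k * x) * hsqrt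

lemma prod_Gamma_ofReal_add_div (hk : 0 < k) {x : ℝ} (hx : 0 < x) :
    ∏ j ∈ range k, Complex.Gamma (x + j / k) =
      (((2 * π) ^ (((k : ℝ) - 1) / 2) * √k : ℝ) : ℂ) * (k : ℂ) ^ (-(k * x) : ℂ) *
        Complex.Gamma (k * x) := by
  have hcast := congrArg Complex.ofReal (prod_Gamma_add_div_of_pos hk hx)
  rw [Complex.ofReal_mul, Complex.ofReal_mul, Complex.ofReal_cpow k.cast_nonneg,
    Complex.ofReal_prod] at hcast
  simpa only [← Complex.Gamma_ofReal, Complex.ofReal_add, Complex.ofReal_div, Complex.ofReal_mul,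
    Complex.ofReal_neg, Complex.ofReal_natCast] using hcast

lemma prod_Gamma_add_div (hk : 0 < k) (z : ℂ) :
    ∏ j ∈ range k, Complex.Gamma (z + j / k) =
      (((2 * π) ^ (((k : ℝ) - 1) / 2) * √k : ℝ) : ℂ) * (k : ℂ) ^ (-(k * z)) *
        Complex.Gamma (k * z) := by
  set c : ℂ := (((2 * π) ^ (((k : ℝ) - 1) / 2) * √k : ℝ) : ℂ)
  have hkC : (k : ℂ) ≠ 0 := mod_cast hk.ne'
  -- The reciprocals are entire, so the poles of `Γ` need no separate treatment.
  suffices (fun z : ℂ => ∏ j ∈ range k, (Complex.Gamma (z + j / k))⁻¹) =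
      fun z : ℂ => c⁻¹ * (k : ℂ) ^ (k * z) * (Complex.Gamma (k * z))⁻¹ by
    rw [← inv_inj, ← prod_inv_distrib, congrFun this z, mul_inv, mul_inv, Complex.cpow_neg, inv_inv]
  have hinv : ∀ g : ℂ → ℂ, Differentiable ℂ g → Differentiable ℂ fun z => (Complex.Gamma (g z))⁻¹ :=
    fun g hg => Complex.differentiable_one_div_Gamma.comp hg
  have hleft : Differentiable ℂ fun z : ℂ => ∏ j ∈ range k, (Complex.Gamma (z + j / k))⁻¹ :=
    .fun_finsetProd fun j _ => hinv _ (by fun_prop)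
  have hright : Differentiable ℂ fun z : ℂ => c⁻¹ * (k : ℂ) ^ (k * z) * (Complex.Gamma (k * z))⁻¹ :=
    .mul (.const_mul (fun t => .const_cpow (by fun_prop) (.inl hkC)) _) (hinv _ (by fun_prop))
  refine AnalyticOnNhd.eq_of_frequently_eq (z₀ := ((1 : ℝ) : ℂ))
    (hleft.differentiableOn.analyticOnNhd isOpen_univ)
    (hright.differentiableOn.analyticOnNhd isOpen_univ) ?_
  have hne : Tendsto ((↑) : ℝ → ℂ) (𝓝[≠] 1) (𝓝[≠] ((1 : ℝ) : ℂ)) :=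
    Complex.continuous_ofReal.continuousWithinAt.tendsto_nhdsWithin fun t ht => by simpa using ht
  refine hne.frequently (Eventually.frequently ?_)
  filter_upwards [(eventually_gt_nhds one_pos).filter_mono nhdsWithin_le_nhds] with x hx
  rw [prod_inv_distrib, prod_Gamma_ofReal_add_div hk hx, mul_inv, mul_inv, Complex.cpow_neg,
    inv_inv]

end GaussMultiplication

section RamanujanMasterTheorem

open Complex Filter MeasureTheory Set
open scoped Real Topology

/-! ### Inverse Mellin transforms of `Γ(s) φ(s)` -/

/-- On every vertical strip of finite width, `φ (σ + i t)` is `O (exp (κ |t|))`, uniformly in `σ`.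
For `κ < π / 2` this growth is beaten by the decay of `Γ`. -/
def ExpBoundedOnStrips (φ : ℂ → ℂ) (κ : ℝ) : Prop :=
  ∀ A B : ℝ, ∃ C, 0 ≤ C ∧ ∀ σ ∈ Icc A B, ∀ t : ℝ, ‖φ (σ + t * I)‖ ≤ C * Real.exp (κ * |t|)

lemma norm_cpow_neg_vertical {y : ℝ} (hy : 0 < y) (σ t : ℝ) :
    ‖(y : ℂ) ^ (-(σ + t * I) : ℂ)‖ = y ^ (-σ) := by
  rw [norm_cpow_eq_rpow_re_of_pos hy]
  simp

lemma differentiable_cpow_neg {y : ℝ} (hy : 0 < y) : Differentiable ℂ fun s : ℂ => (y : ℂ) ^ (-s) :=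
  fun _ => differentiableAt_id.neg.const_cpow (.inl (ofReal_ne_zero.2 hy.ne'))

lemma rpow_neg_le_add {y : ℝ} (hy : 0 < y) {A B σ : ℝ} (hσ : σ ∈ Icc A B) :
    y ^ (-σ) ≤ y ^ (-A) + y ^ (-B) := by
  have hA : 0 < y ^ (-A) := Real.rpow_pos_of_pos hy _
  have hB : 0 < y ^ (-B) := Real.rpow_pos_of_pos hy _
  rcases le_total 1 y with h | h
  · linarith [Real.rpow_le_rpow_of_exponent_le h (neg_le_neg hσ.1)]
  · linarith [Real.rpow_le_rpow_of_exponent_ge hy h (neg_le_neg hσ.2)]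

lemma mellinInv_Gamma_mul (φ : ℂ → ℂ) (c y : ℝ) :
    mellinInv c (fun s => Gamma s * φ s) y = (2 * π : ℂ)⁻¹ *
      ∫ t : ℝ, Gamma (c + t * I) * ((y : ℂ) ^ (-(c + t * I) : ℂ) * φ (c + t * I)) := by
  simp [mellinInv, mul_left_comm (Gamma _)]

namespace ExpBoundedOnStrips

variable {φ : ℂ → ℂ} {κ : ℝ}

lemma cpow_neg_mul (hφ : ExpBoundedOnStrips φ κ) {y : ℝ} (hy : 0 < y) :
    ExpBoundedOnStrips (fun s => (y : ℂ) ^ (-s) * φ s) κ := fun A B => by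
  obtain ⟨C, hC, h⟩ := hφ A B
  refine ⟨(y ^ (-A) + y ^ (-B)) * C, by positivity, fun σ hσ t => ?_⟩
  rw [norm_mul, norm_cpow_neg_vertical hy, mul_assoc]
  gcongr
  · exact rpow_neg_le_add hy hσ
  · exact h σ hσ t

lemma exists_norm_Gamma_mul_le (hφ : ExpBoundedOnStrips φ κ) (hκ : κ < π / 2) {A : ℝ} (hA : 0 < A)
    (B : ℝ) : ∃ C, ∀ σ ∈ Icc A B, ∀ t : ℝ,
      ‖Gamma (σ + t * I) * φ (σ + t * I)‖ ≤ C * Real.exp (-((π / 2 - κ) / 2 * |t|)) := by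
  obtain ⟨M, hM, hΓ⟩ := exists_norm_Gamma_le hA B (ε := (π / 2 - κ) / 2) (by linarith)
  obtain ⟨C, -, h⟩ := hφ A B
  refine ⟨M * C, fun σ hσ t => ?_⟩
  calc ‖Gamma (σ + t * I) * φ (σ + t * I)‖
      ≤ M * Real.exp (-((π / 2 - (π / 2 - κ) / 2) * |t|)) * (C * Real.exp (κ * |t|)) := by
        rw [norm_mul]
        exact mul_le_mul (hΓ σ hσ t) (h σ hσ t) (norm_nonneg _) (by positivity)
    _ = M * C * Real.exp (-((π / 2 - κ) / 2 * |t|)) := by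
        rw [mul_mul_mul_comm, ← Real.exp_add]
        ring_nf

lemma verticalIntegrable_Gamma_mul (hφ : ExpBoundedOnStrips φ κ) (hκ : κ < π / 2)
    (hd : Differentiable ℂ φ) {c : ℝ} (hc : 0 < c) :
    VerticalIntegrable (fun s => Gamma s * φ s) c := by
  obtain ⟨C, hC⟩ := hφ.exists_norm_Gamma_mul_le hκ hc c
  exact integrable_of_norm_le_exp (continuous_comp_vertical_line (S := Ioi 0)
    (differentiableOn_Gamma.continuousOn.mul hd.continuous.continuousOn) hc)
    (by linarith) (hC c ⟨le_rfl, le_rfl⟩)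

lemma mellinInv_Gamma_mul_eq (hφ : ExpBoundedOnStrips φ κ) (hκ : κ < π / 2)
    (hd : Differentiable ℂ φ) {y : ℝ} (hy : 0 < y) {c c' : ℝ} (hc : 0 < c) (hc' : 0 < c') :
    mellinInv c (fun s => Gamma s * φ s) y = mellinInv c' (fun s => Gamma s * φ s) y := by
  wlog hcc : c ≤ c' generalizing c c'
  · exact (this hc' hc (le_of_not_ge hcc)).symm
  obtain ⟨C, hC⟩ := (hφ.cpow_neg_mul hy).exists_norm_Gamma_mul_le hκ hc c'
  have hdiff := differentiableOn_Gamma.fun_mul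
    ((differentiable_cpow_neg hy).fun_mul hd).differentiableOn
  have hline := integral_vertical_eq hcc (hdiff.mono fun s hs => hc.trans_le hs.1)
    (by linarith : 0 < (π / 2 - κ) / 2) hC
  rw [mellinInv_Gamma_mul, mellinInv_Gamma_mul, hline]

lemma mellinInv_Gamma_mul_half_sub (hφ : ExpBoundedOnStrips φ κ) (hκ : κ < π / 2)
    (hd : Differentiable ℂ φ) {y : ℝ} (hy : 0 < y) (r : ℕ) :
    mellinInv (1 / 2 - r) (fun s => Gamma s * φ s) y =
      (-1) ^ r / r.factorial * φ (-r) * (y : ℂ) ^ r +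
        mellinInv (1 / 2 - (r + 1 : ℕ)) (fun s => Gamma s * φ s) y := by
  obtain ⟨C, -, hC⟩ := hφ.cpow_neg_mul hy (-(1 / 2) - r) (1 / 2 - r)
  have hres := integral_vertical_Gamma_mul_sub r
    ((differentiable_cpow_neg hy).fun_mul hd).differentiableOn hκ hC
  rw [show (-(1 / 2) - r : ℝ) = 1 / 2 - (r + 1 : ℕ) by push_cast; ring] at hres
  rw [mellinInv_Gamma_mul, mellinInv_Gamma_mul, ← sub_eq_iff_eq_add, ← mul_sub, hres, neg_neg,
    cpow_natCast]
  have hπ : (π : ℂ) ≠ 0 := ofReal_ne_zero.2 Real.pi_ne_zero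
  field_simp

lemma mellinInv_Gamma_mul_eq_sum_add (hφ : ExpBoundedOnStrips φ κ) (hκ : κ < π / 2)
    (hd : Differentiable ℂ φ) {y : ℝ} (hy : 0 < y) (N : ℕ) :
    mellinInv (1 / 2) (fun s => Gamma s * φ s) y =
      (∑ r ∈ Finset.range N, (-1) ^ r / r.factorial * φ (-r) * (y : ℂ) ^ r) +
        mellinInv (1 / 2 - N) (fun s => Gamma s * φ s) y := by
  induction N with
  | zero => simp
  | succ N ih =>
    rw [ih, hφ.mellinInv_Gamma_mul_half_sub hκ hd hy, Finset.sum_range_succ, add_assoc]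

lemma hasSum_mellinInv_Gamma_mul (hφ : ExpBoundedOnStrips φ κ) (hκ : κ < π / 2)
    (hd : Differentiable ℂ φ) {y : ℝ} (hy : 0 < y) {c : ℝ} (hc : 0 < c)
    (hs : Summable fun r : ℕ => (-1) ^ r / r.factorial * φ (-r) * (y : ℂ) ^ r)
    (hleft : Tendsto (fun N : ℕ => mellinInv (1 / 2 - N) (fun s => Gamma s * φ s) y) atTop (𝓝 0)) :
    HasSum (fun r : ℕ => (-1) ^ r / r.factorial * φ (-r) * (y : ℂ) ^ r)
      (mellinInv c (fun s => Gamma s * φ s) y) := by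
  rw [hφ.mellinInv_Gamma_mul_eq hκ hd hy hc one_half_pos, hs.hasSum_iff_tendsto_nat]
  have hpartial := hleft.const_sub (mellinInv (1 / 2) (fun s => Gamma s * φ s) y)
  rw [sub_zero] at hpartial
  exact hpartial.congr fun N => sub_eq_of_eq_add (hφ.mellinInv_Gamma_mul_eq_sum_add hκ hd hy N)

end ExpBoundedOnStrips

lemma norm_mellinInv_le_of_norm_le {φ : ℂ → ℂ} {c y K δ : ℝ} (hy : 0 < y) (hδ : 0 < δ)
    (h : ∀ t : ℝ, ‖φ (c + t * I)‖ ≤ K * Real.exp (-(δ * |t|))) :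
    ‖mellinInv c φ y‖ ≤ y ^ (-c) * K * ∫ t : ℝ, Real.exp (-(δ * |t|)) := by
  have hint : ‖∫ t : ℝ, (y : ℂ) ^ (-(c + t * I) : ℂ) • φ (c + t * I)‖ ≤
      ∫ t : ℝ, y ^ (-c) * K * Real.exp (-(δ * |t|)) :=
    norm_integral_le_of_norm_le ((integrable_exp_neg_mul_abs hδ).const_mul _) <|
      Eventually.of_forall fun t => by
        rw [norm_smul, norm_cpow_neg_vertical hy, mul_assoc]
        gcongr
        exact h t
  rw [integral_const_mul] at hint
  rw [mellinInv, norm_smul, Real.norm_of_nonneg (by positivity)]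
  refine (mul_le_of_le_one_left (norm_nonneg _) ?_).trans hint
  rw [div_le_one (by positivity)]
  linarith [Real.pi_gt_three]

end RamanujanMasterTheorem

section MellinInversion

open Complex MeasureTheory Set
open scoped Real FourierTransform

/-! ### Mellin inversion and moments -/

lemma exp_smul_mellinInv_exp_neg (φ : ℂ → ℂ) (σ u : ℝ) :
    Real.exp (-σ * u) • mellinInv σ φ (Real.exp (-u)) =
      𝓕⁻ (fun y : ℝ => φ (σ + 2 * π * y * I)) u := by
  rw [mellinInv_eq_fourierInv _ _ (Real.exp_pos _), Real.log_exp, neg_neg, ← ofReal_neg,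
    ← ofReal_cpow (Real.exp_pos _).le, ← Real.exp_mul, real_smul, smul_eq_mul, ← mul_assoc,
    ← ofReal_mul, ← Real.exp_add, neg_mul_neg, mul_comm u, neg_mul, neg_add_cancel, Real.exp_zero,
    ofReal_one, one_mul]

lemma integrable_exp_smul_comp_exp_neg {f : ℝ → ℂ} {σ : ℝ} (hf : MellinConvergent f σ) :
    Integrable fun u : ℝ => Real.exp (-σ * u) • f (Real.exp (-u)) := by
  rw [MellinConvergent, ← Real.range_exp, ← image_univ,
    integrableOn_image_iff_integrableOn_abs_deriv_smul MeasurableSet.univ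
      (fun x _ => (Real.hasDerivAt_exp x).hasDerivWithinAt) Real.exp_injective.injOn,
    integrableOn_univ] at hf
  refine hf.comp_neg.congr (.of_forall fun u => ?_)
  simp only
  rw [Real.abs_exp, ← ofReal_one, ← ofReal_sub, ← ofReal_cpow (Real.exp_pos _).le,
    ← Real.exp_mul, coe_smul, smul_smul, ← Real.exp_add]
  ring_nf

lemma mellin_mellinInv_eq {φ : ℂ → ℂ} {σ : ℝ} (hc : Continuous fun t : ℝ => φ (σ + t * I))
    (hi : VerticalIntegrable φ σ) (hm : MellinConvergent (mellinInv σ φ) σ) :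
    mellin (mellinInv σ φ) σ = φ σ := by
  set G : ℝ → ℂ := fun y => φ (σ + 2 * π * y * I) with hG
  have hGscale : G = fun y => (fun t : ℝ => φ (σ + t * I)) (2 * π * y) := by
    ext y
    simp [hG]
  have hGc : Continuous G := hGscale ▸ hc.comp (by fun_prop)
  have hGi : Integrable G := hGscale ▸ Integrable.comp_mul_left' hi (by positivity)
  have hFi : Integrable (𝓕⁻ G) := by
    simpa only [exp_smul_mellinInv_exp_neg] using integrable_exp_smul_comp_exp_neg hm
  have hFi' : Integrable (𝓕 G) := by
    simpa [Real.fourierInv_eq_fourier_neg] using hFi.comp_neg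
  rw [mellin_eq_fourier]
  simp only [ofReal_re, ofReal_im, zero_div, exp_smul_mellinInv_exp_neg]
  rw [hGc.fourier_fourierInv_eq hGi hFi']
  simp [hG]

lemma ExpBoundedOnStrips.integral_pow_mul_mellinInv {φ : ℂ → ℂ} {κ : ℝ}
    (hφ : ExpBoundedOnStrips φ κ) (hκ : κ < π / 2) (hd : Differentiable ℂ φ) (r : ℕ)
    (hint : IntegrableOn
      (fun y : ℝ => (y : ℂ) ^ r * mellinInv 1 (fun s => Gamma s * φ s) y) (Ioi 0)) :
    ∫ y in Ioi (0 : ℝ), (y : ℂ) ^ r * mellinInv 1 (fun s => Gamma s * φ s) y =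
      r.factorial * φ (r + 1) := by
  have hr : (0 : ℝ) < (r + 1 : ℕ) := by positivity
  have hintegrand : ∀ y ∈ Ioi (0 : ℝ), (y : ℂ) ^ r * mellinInv 1 (fun s => Gamma s * φ s) y =
      (y : ℂ) ^ (((r + 1 : ℕ) : ℝ) - 1 : ℂ) •
        mellinInv (r + 1 : ℕ) (fun s => Gamma s * φ s) y := fun y hy => by
    rw [hφ.mellinInv_Gamma_mul_eq hκ hd hy one_pos hr]
    simp
  have hinv := mellin_mellinInv_eq (continuous_comp_vertical_line (S := Ioi 0)
    (differentiableOn_Gamma.continuousOn.fun_mul hd.continuous.continuousOn) hr)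
    (hφ.verticalIntegrable_Gamma_mul hκ hd hr) (hint.congr_fun hintegrand measurableSet_Ioi)
  rw [setIntegral_congr_fun measurableSet_Ioi hintegrand, ← Gamma_nat_eq_factorial]
  simpa [mellin] using hinv

end MellinInversion

section SuperexponentialDecay

open Filter MeasureTheory Set

/-! ### Functions of superexponential decay and their Laplace transforms -/

/-- On `(0, ∞)`, `u` is bounded by a multiple of every decaying exponential.  No behaviour is
prescribed on `(-∞, 0]`. -/
def SuperexponentialDecay {E : Type*} [NormedAddCommGroup E] (u : ℝ → E) : Prop :=
  ∀ X : ℝ, 0 ≤ X → ∃ C, ∀ y : ℝ, 0 < y → ‖u y‖ ≤ C * Real.exp (-(X * y))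

lemma superexponentialDecay_of_pow_mul_norm_le {E : Type*} [NormedAddCommGroup E] {u : ℝ → E}
    {K : ℝ} (hK : ∀ y : ℝ, 0 < y → y ≤ 1 → ‖u y‖ ≤ K) {q : ℕ → ℝ}
    (hq : ∀ᶠ N in atTop, ∀ y : ℝ, 1 ≤ y → y ^ N * ‖u y‖ ≤ q N)
    (hs : ∀ X : ℝ, Summable fun N : ℕ => X ^ N / N.factorial * q N) :
    SuperexponentialDecay u := fun X hX => by
  obtain ⟨M, hM⟩ := eventually_atTop.1 hq
  have hsM : Summable fun N : ℕ => X ^ N / N.factorial * q (max N M) :=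
    (summable_congr_atTop <| (eventually_ge_atTop M).mono fun N hN => by
      rw [max_eq_left hN]).2 (hs X)
  set S := ∑' N : ℕ, X ^ N / N.factorial * q (max N M)
  have hlarge : ∀ y : ℝ, 1 ≤ y → Real.exp (X * y) * ‖u y‖ ≤ S := fun y hy => by
    have hexp : HasSum (fun N : ℕ => (X * y) ^ N / N.factorial * ‖u y‖)
        (Real.exp (X * y) * ‖u y‖) := by
      rw [Real.exp_eq_exp_ℝ]
      exact (NormedSpace.expSeries_div_hasSum_exp (X * y)).mul_right _
    -- Summing the moment bounds against `X ^ N / N!` turns them into a bound for `exp (X y) ‖u y‖`.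
    refine hasSum_le (fun N => ?_) hexp hsM.hasSum
    calc (X * y) ^ N / N.factorial * ‖u y‖
        = X ^ N / N.factorial * (y ^ N * ‖u y‖) := by
          rw [mul_pow]
          ring
      _ ≤ X ^ N / N.factorial * (y ^ max N M * ‖u y‖) := by
          gcongr
          exact le_max_left _ _
      _ ≤ X ^ N / N.factorial * q (max N M) := by
          gcongr
          exact hM _ (le_max_right _ _) y hy
  refine ⟨max S (K * Real.exp X), fun y hy => ?_⟩
  rw [Real.exp_neg, ← div_eq_mul_inv, le_div_iff₀ (Real.exp_pos _), mul_comm]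
  rcases le_total y 1 with hy1 | hy1
  · calc Real.exp (X * y) * ‖u y‖ ≤ Real.exp X * K :=
          mul_le_mul (Real.exp_le_exp.2 (mul_le_of_le_one_right hX hy1)) (hK y hy hy1)
            (norm_nonneg _) (Real.exp_pos _).le
      _ ≤ max S (K * Real.exp X) := mul_comm K (Real.exp X) ▸ le_max_right _ _
  · exact (hlarge y hy1).trans (le_max_left _ _)

lemma aestronglyMeasurable_of_hasSum_pow {u : ℝ → ℂ} {c : ℕ → ℂ}
    (hu : ∀ y : ℝ, 0 < y → HasSum (fun r => c r * (y : ℂ) ^ r) (u y)) :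
    AEStronglyMeasurable u (volume.restrict (Ioi 0)) :=
  aestronglyMeasurable_of_tendsto_ae atTop
    (f := fun N (y : ℝ) => ∑ r ∈ Finset.range N, c r * (y : ℂ) ^ r)
    (fun _ => Continuous.aestronglyMeasurable (by fun_prop))
    ((ae_restrict_mem measurableSet_Ioi).mono fun y hy => (hu y hy).tendsto_sum_nat)

lemma integrableOn_pow_mul_exp_neg (r : ℕ) {X : ℝ} (hX : 0 < X) :
    IntegrableOn (fun y : ℝ => y ^ r * Real.exp (-(X * y))) (Ioi 0) := by
  simpa using integrableOn_rpow_mul_exp_neg_mul_rpow (p := 1) (s := r) (b := X)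
    (neg_one_lt_zero.trans_le r.cast_nonneg) one_pos hX

lemma integral_pow_mul_exp_neg (r : ℕ) {X : ℝ} (hX : 0 < X) :
    ∫ y in Ioi (0 : ℝ), y ^ r * Real.exp (-(X * y)) = r.factorial / X ^ (r + 1) := by
  have h := Real.integral_rpow_mul_exp_neg_mul_Ioi (a := r + 1) (r := X) (by positivity) hX
  rw [Real.Gamma_nat_eq_factorial, ← Nat.cast_add_one, Real.rpow_natCast, one_div, inv_pow,
    inv_mul_eq_div] at h
  simpa using h

namespace SuperexponentialDecay

variable {u : ℝ → ℂ}

lemma integrableOn_mul (hu : SuperexponentialDecay u)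
    (hm : AEStronglyMeasurable u (volume.restrict (Ioi 0))) {f : ℝ → ℂ} (hf : Continuous f)
    {r : ℕ} {X : ℝ} (hX : 0 ≤ X) (hfX : ∀ y : ℝ, 0 < y → ‖f y‖ ≤ y ^ r * Real.exp (X * y)) :
    IntegrableOn (fun y => f y * u y) (Ioi 0) := by
  obtain ⟨C, hC⟩ := hu (X + 1) (by linarith)
  refine Integrable.mono' ((integrableOn_pow_mul_exp_neg r one_pos).const_mul C)
    (hf.aestronglyMeasurable.mul hm) ?_
  filter_upwards [ae_restrict_mem measurableSet_Ioi] with y (hy : 0 < y)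
  calc ‖f y * u y‖ ≤ y ^ r * Real.exp (X * y) * (C * Real.exp (-((X + 1) * y))) := by
        rw [norm_mul]
        exact mul_le_mul (hfX y hy) (hC y hy) (norm_nonneg _) (by positivity)
    _ = C * (y ^ r * Real.exp (-(1 * y))) := by
        rw [mul_mul_mul_comm, ← Real.exp_add]
        ring_nf

lemma integrableOn_pow_mul (hu : SuperexponentialDecay u)
    (hm : AEStronglyMeasurable u (volume.restrict (Ioi 0))) (r : ℕ) :
    IntegrableOn (fun y : ℝ => (y : ℂ) ^ r * u y) (Ioi 0) :=
  hu.integrableOn_mul hm (r := r) (by fun_prop) le_rfl fun y hy => by simp [abs_of_pos hy]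

lemma integrableOn_exp_neg_mul (hu : SuperexponentialDecay u)
    (hm : AEStronglyMeasurable u (volume.restrict (Ioi 0))) (x : ℝ) :
    IntegrableOn (fun y : ℝ => (Real.exp (-(x * y)) : ℂ) * u y) (Ioi 0) :=
  hu.integrableOn_mul hm (r := 0) (by fun_prop) (abs_nonneg x) fun y hy => by
    rw [Complex.norm_real, Real.norm_of_nonneg (Real.exp_pos _).le, pow_zero, one_mul]
    exact Real.exp_le_exp.2 (by nlinarith [neg_abs_le x])

lemma summable_integral_norm (hu : SuperexponentialDecay u)
    (hm : AEStronglyMeasurable u (volume.restrict (Ioi 0))) (x : ℂ) :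
    Summable fun r : ℕ => ∫ y in Ioi (0 : ℝ), ‖x ^ r / r.factorial * ((y : ℂ) ^ r * u y)‖ := by
  have hX : 0 < ‖x‖ + 1 := by positivity
  obtain ⟨C, hC⟩ := hu _ hX.le
  refine Summable.of_nonneg_of_le (fun r => integral_nonneg fun y => norm_nonneg _) (fun r => ?_)
    ((summable_geometric_of_lt_one (r := ‖x‖ / (‖x‖ + 1)) (by positivity)
      (by rw [div_lt_one hX]; linarith)).mul_left (C / (‖x‖ + 1)))
  calc ∫ y in Ioi (0 : ℝ), ‖x ^ r / r.factorial * ((y : ℂ) ^ r * u y)‖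
      ≤ ∫ y in Ioi (0 : ℝ), C * (‖x‖ ^ r / r.factorial) *
          (y ^ r * Real.exp (-((‖x‖ + 1) * y))) := by
        refine setIntegral_mono_on ((hu.integrableOn_pow_mul hm r).const_mul _).norm
          ((integrableOn_pow_mul_exp_neg r hX).const_mul _) measurableSet_Ioi
          fun y (hy : 0 < y) => ?_
        rw [norm_mul, norm_mul, norm_div, norm_pow, norm_pow, Complex.norm_real,
          Real.norm_of_nonneg hy.le, RCLike.norm_natCast, mul_comm C, mul_assoc,
          mul_left_comm C]
        gcongr
        exact hC y hy
    _ = C / (‖x‖ + 1) * (‖x‖ / (‖x‖ + 1)) ^ r := by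
        rw [integral_const_mul, integral_pow_mul_exp_neg r hX, div_pow, pow_succ]
        have hr : (r.factorial : ℝ) ≠ 0 := by positivity
        field_simp

lemma hasSum_laplace (hu : SuperexponentialDecay u)
    (hm : AEStronglyMeasurable u (volume.restrict (Ioi 0))) (x : ℝ) :
    HasSum (fun r : ℕ => (-x : ℂ) ^ r / r.factorial * ∫ y in Ioi (0 : ℝ), (y : ℂ) ^ r * u y)
      (∫ y in Ioi (0 : ℝ), (Real.exp (-(x * y)) : ℂ) * u y) := by
  have h := hasSum_integral_of_summable_integral_norm
    (fun r => (hu.integrableOn_pow_mul hm r).const_mul ((-x : ℂ) ^ r / r.factorial))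
    (hu.summable_integral_norm hm (-x))
  have hexp : ∀ y : ℝ, ∑' r : ℕ, (-x : ℂ) ^ r / r.factorial * ((y : ℂ) ^ r * u y) =
      (Real.exp (-(x * y)) : ℂ) * u y := fun y => by
    have hsum := (NormedSpace.expSeries_div_hasSum_exp (-x * y : ℂ)).mul_right (u y)
    rw [← Complex.exp_eq_exp_ℂ] at hsum
    rw [Complex.ofReal_exp, Complex.ofReal_neg, Complex.ofReal_mul, ← neg_mul, ← hsum.tsum_eq]
    refine tsum_congr fun r => ?_
    rw [mul_pow]
    ring
  simpa only [integral_const_mul, hexp] using h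

end SuperexponentialDecay

end SuperexponentialDecay

section LeRoyMellin

open Complex Filter MeasureTheory Set
open scoped Real Topology

/-! ### The inverse Mellin transform of `Γ(s) / Γ(β + α (s - 1)) ^ n` -/

/-- The entire function `Γ(β + α (s - 1)) ^ (-n)`.  With this shift its value at `r + 1` is the
`r`-th coefficient of the Mittag-Leffler function of Le Roy type. -/
noncomputable def leRoyFactor (n : ℕ) (α β : ℝ) (s : ℂ) : ℂ := (Gamma (β + α * (s - 1)))⁻¹ ^ n

/-- The function on `(0, ∞)` with Mellin transform `Γ(s) / Γ(β + α (s - 1)) ^ n`; it is the weight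
of the Laplace representation, for any real `α` with `0 < n α < 1`. -/
noncomputable def leRoyDensity (n : ℕ) (α β : ℝ) : ℝ → ℂ :=
  mellinInv 1 fun s => Gamma s * leRoyFactor n α β s

/-- The coefficients of the power series of `leRoyDensity`: the residues of
`Γ(s) / Γ(β + α (s - 1)) ^ n` at `s = -r`. -/
noncomputable def leRoyTaylor (n : ℕ) (α β : ℝ) (r : ℕ) : ℝ :=
  (-1) ^ r / (r.factorial * Real.Gamma (β - α * (1 + r)) ^ n)

variable {n : ℕ} {α : ℝ}

lemma leRoyFactor_natCast_add_one (n : ℕ) (α β : ℝ) (r : ℕ) :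
    leRoyFactor n α β (r + 1) = ((Real.Gamma (β + α * r) ^ n)⁻¹ : ℝ) := by
  rw [leRoyFactor, add_sub_cancel_right, ← ofReal_natCast, ← ofReal_mul, ← ofReal_add,
    Gamma_ofReal, inv_pow, ← ofReal_pow, ← ofReal_inv]

lemma neg_one_pow_div_mul_leRoyFactor_neg (n : ℕ) (α β : ℝ) (r : ℕ) :
    (-1) ^ r / r.factorial * leRoyFactor n α β (-r) = leRoyTaylor n α β r := by
  rw [leRoyFactor, show (β + α * (-r - 1) : ℂ) = (β - α * (1 + r) : ℝ) by push_cast; ring,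
    Gamma_ofReal, leRoyTaylor]
  push_cast
  ring

lemma leRoyFactor_vertical (n : ℕ) (α β σ t : ℝ) :
    leRoyFactor n α β (σ + t * I) =
      (Gamma ((β + α * (σ - 1) : ℝ) + (α * t : ℝ) * I))⁻¹ ^ n := by
  rw [leRoyFactor]
  push_cast
  ring_nf

lemma differentiable_leRoyFactor (n : ℕ) (α β : ℝ) : Differentiable ℂ (leRoyFactor n α β) :=
  (differentiable_one_div_Gamma.comp (f := fun s : ℂ => β + α * (s - 1)) (by fun_prop)).fun_pow n

lemma norm_leRoyFactor_vertical_le (hα : 0 < α) {β σ t C κ : ℝ}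
    (h : ‖(Gamma ((β + α * (σ - 1) : ℝ) + (α * t : ℝ) * I))⁻¹‖ ≤ C * Real.exp (κ * |α * t|)) :
    ‖leRoyFactor n α β (σ + t * I)‖ ≤ C ^ n * Real.exp (n * (α * κ) * |t|) := by
  rw [leRoyFactor_vertical, norm_pow]
  refine (pow_le_pow_left₀ (norm_nonneg _) h n).trans_eq ?_
  rw [mul_pow, ← Real.exp_nat_mul, abs_mul, abs_of_pos hα]
  ring_nf

lemma expBoundedOnStrips_leRoyFactor (n : ℕ) (hα : 0 < α) (β : ℝ) {ε : ℝ} (hε : 0 < ε) :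
    ExpBoundedOnStrips (leRoyFactor n α β) (n * (α * (π / 2 + ε))) := fun A B => by
  obtain ⟨C, hC, h⟩ := exists_norm_inv_Gamma_le (β + α * (A - 1)) (β + α * (B - 1)) hε
  exact ⟨C ^ n, by positivity, fun σ hσ t => norm_leRoyFactor_vertical_le hα
    (h _ ⟨by gcongr; exact hσ.1, by gcongr; exact hσ.2⟩ _)⟩

lemma exists_pos_add_mul_lt_pi_div_two (hnα : n * α < 1) :
    ∃ ε : ℝ, 0 < ε ∧ ε + n * (α * (π / 2 + ε)) < π / 2 := by
  have hgap : 0 < 1 - n * α := by linarith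
  refine ⟨π / 8 * (1 - n * α), by positivity, ?_⟩
  nlinarith [Real.pi_pos, mul_pos Real.pi_pos hgap, mul_pos hgap hgap,
    mul_pos Real.pi_pos (mul_pos hgap hgap)]

lemma leRoyDensity_eq_mellinInv (hα : 0 < α) (hnα : n * α < 1) (β : ℝ) {c y : ℝ} (hy : 0 < y)
    (hc : 0 < c) :
    leRoyDensity n α β y = mellinInv c (fun s => Gamma s * leRoyFactor n α β s) y := by
  obtain ⟨ε, hε, hεα⟩ := exists_pos_add_mul_lt_pi_div_two hnα
  exact (expBoundedOnStrips_leRoyFactor n hα β hε).mellinInv_Gamma_mul_eq (by linarith)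
    (differentiable_leRoyFactor n α β) hy one_pos hc

lemma verticalIntegrable_cpow_mul_leRoyFactor (hα : 0 < α) (hnα : n * α < 1) (β : ℝ) {c y : ℝ}
    (hy : 0 < y) (hc : 0 < c) :
    VerticalIntegrable (fun s => (y : ℂ) ^ (-s) * (Gamma s * leRoyFactor n α β s)) c := by
  obtain ⟨ε, hε, hεα⟩ := exists_pos_add_mul_lt_pi_div_two hnα
  have hcomm : (fun s => (y : ℂ) ^ (-s) * (Gamma s * leRoyFactor n α β s)) =
      fun s => Gamma s * ((y : ℂ) ^ (-s) * leRoyFactor n α β s) :=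
    funext fun s => mul_left_comm _ _ _
  rw [hcomm]
  exact ((expBoundedOnStrips_leRoyFactor n hα β hε).cpow_neg_mul hy).verticalIntegrable_Gamma_mul
    (by linarith) ((differentiable_cpow_neg hy).fun_mul (differentiable_leRoyFactor n α β)) hc

lemma norm_inv_Gamma_one_sub_le {x : ℝ} (hx : 0 < x) (t : ℝ) {ε : ℝ} (hε : 0 < ε) :
    ‖(Gamma ((1 - x : ℝ) + t * I))⁻¹‖ ≤
      √2 * (2 * Real.exp ε / ε) ^ (x + 1) * Real.Gamma x / π *
        Real.exp ((π / 2 + ε) * |t|) := by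
  have hre : ((1 - x : ℝ) + t * I : ℂ).re < 1 := by simpa
  have him : ((1 - x : ℝ) + t * I : ℂ).im = t := by simp
  have hrefl : 1 - ((1 - x : ℝ) + t * I : ℂ) = x + (-t : ℝ) * I := by
    push_cast
    ring
  have hΓ := norm_Gamma_le hx (-t) hε
  have hinv := norm_inv_Gamma_le_of_re_lt_one hre
  rw [him, hrefl] at hinv
  rw [abs_neg] at hΓ
  calc _ ≤ _ := hinv
    _ ≤ Real.exp (π * |t|) * (√2 * (2 * Real.exp ε / ε) ^ (x + 1) * Real.Gamma x *
          Real.exp (-((π / 2 - ε) * |t|))) / π := by gcongr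
    _ = √2 * (2 * Real.exp ε / ε) ^ (x + 1) * Real.Gamma x / π *
          (Real.exp (π * |t|) * Real.exp (-((π / 2 - ε) * |t|))) := by ring
    _ = _ := by
        rw [← Real.exp_add]
        ring_nf

lemma norm_Gamma_mul_leRoyFactor_left_le (hα : 0 < α) {β : ℝ} {N : ℕ}
    (hN : 0 < 1 - β + α / 2 + α * N) {ε : ℝ} (hε : 0 < ε) (t : ℝ) :
    ‖Gamma ((1 / 2 - N : ℝ) + t * I) * leRoyFactor n α β ((1 / 2 - N : ℝ) + t * I)‖ ≤
      2 * π / Real.Gamma (N + 1 / 2) *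
        (√2 * (2 * Real.exp ε / ε) ^ (1 - β + α / 2 + α * N + 1) *
          Real.Gamma (1 - β + α / 2 + α * N) / π) ^ n *
        Real.exp (-((π / 2 - n * (α * (π / 2 + ε))) * |t|)) := by
  have hfactor := norm_leRoyFactor_vertical_le (n := n) (β := β) (σ := 1 / 2 - N) hα <| by
    rw [show β + α * (1 / 2 - N - 1) = 1 - (1 - β + α / 2 + α * N) by ring]
    exact norm_inv_Gamma_one_sub_le hN (α * t) hε
  rw [norm_mul]
  refine (mul_le_mul (norm_Gamma_half_sub_natCast_le N t) hfactor (norm_nonneg _)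
    (by have := Real.Gamma_pos_of_pos (s := N + 1 / 2) (by positivity); positivity)).trans_eq ?_
  rw [mul_mul_mul_comm, ← Real.exp_add]
  ring_nf

lemma tendsto_mellinInv_leRoyFactor_left (hα : 0 < α) (hnα : n * α < 1) (β : ℝ) {y : ℝ}
    (hy : 0 < y) :
    Tendsto (fun N : ℕ => mellinInv (1 / 2 - N) (fun s => Gamma s * leRoyFactor n α β s) y)
      atTop (𝓝 0) := by
  obtain ⟨ε, hε, hεα⟩ := exists_pos_add_mul_lt_pi_div_two hnα
  set D : ℝ := 2 * Real.exp ε / ε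
  have hD : 0 < D := by positivity
  set p : ℝ := 1 - β + α / 2
  set J : ℝ := ∫ t : ℝ, Real.exp (-((π / 2 - n * (α * (π / 2 + ε))) * |t|))
  have hlim := ((summable_Gamma_pow_mul_pow_div_Gamma hα hnα p (1 / 2)
    (y * (D ^ α) ^ n)).tendsto_atTop_zero).const_mul
      (y ^ (-(1 / 2) : ℝ) * (2 * π) * (√2 * D ^ (p + 1) / π) ^ n * J)
  rw [mul_zero] at hlim
  refine squeeze_zero_norm' ?_ hlim
  filter_upwards [eventually_le_add_mul_natCast hα p 1] with N hN
  refine (norm_mellinInv_le_of_norm_le hy (by linarith) fun t =>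
    norm_Gamma_mul_leRoyFactor_left_le hα (one_pos.trans_le hN) hε t).trans_eq ?_
  have hypow : y ^ (-(1 / 2 - N) : ℝ) = y ^ (-(1 / 2) : ℝ) * y ^ N := by
    rw [neg_sub, sub_eq_neg_add, Real.rpow_add hy, Real.rpow_natCast]
  have hDpow : D ^ (p + α * N + 1) = D ^ (p + 1) * (D ^ α) ^ N := by
    rw [add_right_comm, Real.rpow_add hD, Real.rpow_mul hD.le, Real.rpow_natCast]
  rw [hypow, hDpow, mul_pow y, pow_right_comm (D ^ α), add_comm (N : ℝ)]
  ring

lemma summable_leRoyTaylor (hα : 0 < α) (hnα : n * α < 1) (β R : ℝ) :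
    Summable fun r : ℕ => ‖leRoyTaylor n α β r‖ * R ^ r := by
  refine Summable.of_norm_bounded_eventually_nat ((summable_Gamma_pow_mul_pow_div_Gamma hα hnα
    (1 - β + α) 1 |R|).mul_left ((π ^ n)⁻¹)) ?_
  filter_upwards [eventually_le_add_mul_natCast hα (1 - β + α) 1] with r hr
  have hΓ := norm_inv_Gamma_le_of_re_lt_one (z := (β - α * (1 + r) : ℝ))
    (by rw [ofReal_re]; linarith)
  rw [← ofReal_one, ← ofReal_sub, Gamma_ofReal, Gamma_ofReal, ← ofReal_inv, norm_real, norm_real,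
    ofReal_im, abs_zero, mul_zero, Real.exp_zero, one_mul,
    show 1 - (β - α * (1 + r)) = 1 - β + α + α * r by ring,
    Real.norm_of_nonneg (Real.Gamma_pos_of_pos (one_pos.trans_le hr)).le] at hΓ
  calc ‖‖leRoyTaylor n α β r‖ * R ^ r‖
      = (r.factorial : ℝ)⁻¹ * ‖(Real.Gamma (β - α * (1 + r)))⁻¹‖ ^ n * |R| ^ r := by
        simp [leRoyTaylor, mul_comm]
    _ ≤ (r.factorial : ℝ)⁻¹ * (Real.Gamma (1 - β + α + α * r) / π) ^ n * |R| ^ r := by gcongr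
    _ = (π ^ n)⁻¹ * (Real.Gamma (1 - β + α + α * r) ^ n * |R| ^ r / Real.Gamma (1 + r)) := by
        rw [add_comm (1 : ℝ) r, Real.Gamma_nat_eq_factorial, div_pow]
        ring

lemma hasSum_leRoyDensity (hα : 0 < α) (hnα : n * α < 1) (β : ℝ) {y : ℝ} (hy : 0 < y) :
    HasSum (fun r : ℕ => (leRoyTaylor n α β r : ℂ) * (y : ℂ) ^ r) (leRoyDensity n α β y) := by
  obtain ⟨ε, hε, hεα⟩ := exists_pos_add_mul_lt_pi_div_two hnα
  have hsum : Summable fun r : ℕ => (leRoyTaylor n α β r : ℂ) * (y : ℂ) ^ r :=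
    .of_norm <| by simpa [abs_of_pos hy] using summable_leRoyTaylor hα hnα β y
  simp only [← neg_one_pow_div_mul_leRoyFactor_neg] at hsum ⊢
  exact (expBoundedOnStrips_leRoyFactor n hα β hε).hasSum_mellinInv_Gamma_mul (by linarith)
    (differentiable_leRoyFactor n α β) hy one_pos hsum
    (tendsto_mellinInv_leRoyFactor_left hα hnα β hy)

lemma radius_ofScalars_leRoyTaylor (hα : 0 < α) (hnα : n * α < 1) (β : ℝ) :
    (FormalMultilinearSeries.ofScalars ℝ (leRoyTaylor n α β)).radius = ⊤ :=
  FormalMultilinearSeries.radius_eq_top_of_summable_norm _ fun R => by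
    simpa only [FormalMultilinearSeries.ofScalars_norm] using summable_leRoyTaylor hα hnα β R

lemma norm_leRoyDensity_le_tsum (hα : 0 < α) (hnα : n * α < 1) (β : ℝ) {y : ℝ} (hy : 0 < y)
    (hy1 : y ≤ 1) : ‖leRoyDensity n α β y‖ ≤ ∑' r, ‖leRoyTaylor n α β r‖ := by
  rw [← (hasSum_leRoyDensity hα hnα β hy).tsum_eq]
  refine tsum_of_norm_bounded (by simpa using (summable_leRoyTaylor hα hnα β 1).hasSum) fun r => ?_
  rw [norm_mul, norm_pow, norm_real, norm_real, Real.norm_of_nonneg hy.le]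
  exact mul_le_of_le_one_right (norm_nonneg _) (pow_le_one₀ hy.le hy1)

lemma norm_Gamma_natCast_vertical_le {N : ℕ} (hN : 0 < N) (t : ℝ) {ε : ℝ} (hε : 0 < ε) :
    ‖Gamma ((N : ℝ) + t * I)‖ ≤ √2 * (2 * Real.exp ε / ε) ^ (N + 1) * N.factorial *
      Real.exp (-((π / 2 - ε) * |t|)) := by
  have hΓ := norm_Gamma_le (Nat.cast_pos.2 hN) t hε
  rw [← Nat.cast_add_one, Real.rpow_natCast] at hΓ
  refine hΓ.trans ?_
  gcongr
  obtain ⟨m, rfl⟩ := Nat.exists_eq_succ_of_ne_zero hN.ne'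
  rw [Nat.cast_succ, Real.Gamma_nat_eq_factorial]
  exact_mod_cast Nat.factorial_le m.le_succ

lemma norm_Gamma_mul_leRoyFactor_right_le (hα : 0 < α) {β : ℝ} {N : ℕ} (hN : 0 < N)
    (hNβ : 1 / 2 ≤ β - α + α * N) {ε : ℝ} (hε : 0 < ε) (t : ℝ) :
    ‖Gamma ((N : ℝ) + t * I) * leRoyFactor n α β ((N : ℝ) + t * I)‖ ≤
      √2 * (2 * Real.exp ε / ε) ^ (N + 1) * N.factorial *
        (Real.Gamma (β - α + α * N))⁻¹ ^ n *
        Real.exp (-((π / 2 - ε - n * (α * (π / 2))) * |t|)) := by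
  have hfactor := norm_leRoyFactor_vertical_le (n := n) (β := β) (σ := N) hα <| by
    rw [show β + α * ((N : ℝ) - 1) = β - α + α * N by ring]
    exact norm_inv_Gamma_le_of_half_le hNβ (α * t)
  rw [norm_mul]
  refine (mul_le_mul (norm_Gamma_natCast_vertical_le hN t hε) hfactor (norm_nonneg _)
    (by positivity)).trans_eq ?_
  rw [mul_mul_mul_comm, ← Real.exp_add]
  ring_nf

lemma superexponentialDecay_leRoyDensity (hn : 0 < n) (hα : 0 < α) (hnα : n * α < 1) (β : ℝ) :
    SuperexponentialDecay (leRoyDensity n α β) := by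
  obtain ⟨ε, hε, hεα⟩ := exists_pos_add_mul_lt_pi_div_two hnα
  set D : ℝ := 2 * Real.exp ε / ε
  set δ : ℝ := π / 2 - ε - n * (α * (π / 2))
  have hδ : 0 < δ := by
    have : 0 ≤ n * (α * ε) := by positivity
    rw [mul_add, mul_add] at hεα
    simp only [δ]
    linarith
  set J : ℝ := ∫ t : ℝ, Real.exp (-(δ * |t|))
  refine superexponentialDecay_of_pow_mul_norm_le
    (fun y hy hy1 => norm_leRoyDensity_le_tsum hα hnα β hy hy1)
    (q := fun N => √2 * D ^ (N + 1) * N.factorial * (Real.Gamma (β - α + α * N))⁻¹ ^ n * J) ?_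
    fun X => ?_
  · filter_upwards [eventually_gt_atTop 0, eventually_le_add_mul_natCast hα (β - α) (1 / 2)]
      with N hN hNβ y hy
    have hy0 : 0 < y := one_pos.trans_le hy
    have hline := norm_mellinInv_le_of_norm_le (c := N)
      (φ := fun s => Gamma s * leRoyFactor n α β s) hy0 hδ fun t =>
      norm_Gamma_mul_leRoyFactor_right_le hα hN hNβ hε t
    rw [leRoyDensity_eq_mellinInv hα hnα β hy0 (Nat.cast_pos.2 hN)]
    refine (mul_le_mul_of_nonneg_left hline (pow_nonneg hy0.le N)).trans_eq ?_
    rw [Real.rpow_neg hy0.le, Real.rpow_natCast, mul_assoc (y ^ N)⁻¹,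
      mul_inv_cancel_left₀ (pow_pos hy0 N).ne']
  · refine ((summable_pow_div_Gamma_pow hn hα (β - α) (X * D)).mul_left (√2 * D * J)).congr
      fun N => ?_
    have hN : (N.factorial : ℝ) ≠ 0 := by positivity
    rw [mul_pow, pow_succ, inv_pow]
    field_simp

lemma exists_norm_leRoyDensity_le (hn : 0 < n) (hα : 0 < α) (hnα : n * α < 1) (β : ℝ) :
    ∃ C : ℝ, ∀ y : ℝ, 0 < y → ‖leRoyDensity n α β y‖ ≤ C := by
  simpa using superexponentialDecay_leRoyDensity hn hα hnα β 0 le_rfl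

lemma aestronglyMeasurable_leRoyDensity (hα : 0 < α) (hnα : n * α < 1) (β : ℝ) :
    AEStronglyMeasurable (leRoyDensity n α β) (volume.restrict (Ioi 0)) :=
  aestronglyMeasurable_of_hasSum_pow fun _ hy => hasSum_leRoyDensity hα hnα β hy

lemma integral_pow_mul_leRoyDensity (hn : 0 < n) (hα : 0 < α) (hnα : n * α < 1) (β : ℝ) (r : ℕ) :
    ∫ y in Ioi (0 : ℝ), (y : ℂ) ^ r * leRoyDensity n α β y =
      r.factorial * ((Real.Gamma (β + α * r) ^ n)⁻¹ : ℝ) := by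
  obtain ⟨ε, hε, hεα⟩ := exists_pos_add_mul_lt_pi_div_two hnα
  rw [← leRoyFactor_natCast_add_one]
  exact (expBoundedOnStrips_leRoyFactor n hα β hε).integral_pow_mul_mellinInv (by linarith)
    (differentiable_leRoyFactor n α β) r
    ((superexponentialDecay_leRoyDensity hn hα hnα β).integrableOn_pow_mul
      (aestronglyMeasurable_leRoyDensity hα hnα β) r)

lemma integrableOn_exp_neg_mul_leRoyDensity (hn : 0 < n) (hα : 0 < α) (hnα : n * α < 1)
    (β x : ℝ) :
    IntegrableOn (fun y : ℝ => (Real.exp (-(x * y)) : ℂ) * leRoyDensity n α β y) (Ioi 0) :=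
  (superexponentialDecay_leRoyDensity hn hα hnα β).integrableOn_exp_neg_mul
    (aestronglyMeasurable_leRoyDensity hα hnα β) x

lemma mittagLefflerLeRoy_eq_laplace (hn : 0 < n) (hα : 0 < α) (hnα : n * α < 1) (β x : ℝ) :
    (mittagLefflerLeRoy n α β (-x) : ℂ) =
      ∫ y in Ioi (0 : ℝ), (Real.exp (-(x * y)) : ℂ) * leRoyDensity n α β y := by
  have hsum := (superexponentialDecay_leRoyDensity hn hα hnα β).hasSum_laplace
    (aestronglyMeasurable_leRoyDensity hα hnα β) x
  rw [← hsum.tsum_eq, mittagLefflerLeRoy, ofReal_tsum]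
  refine tsum_congr fun r => ?_
  have hr : (r.factorial : ℂ) ≠ 0 := by exact_mod_cast r.factorial_ne_zero
  rw [integral_pow_mul_leRoyDensity hn hα hnα]
  push_cast
  field_simp

end LeRoyMellin

section MeijerWeight

open Complex Filter MeasureTheory Set
open scoped Real Topology

/-! ### The Meijer function of the weight -/

/-- The factor `(2π) ^ ((1 - k) / 2 - n (1 - l) / 2) k ^ (3 / 2) l ^ (-n (β - 1 / 2))` in front of
`y⁻¹ G(l ^ (n l) y ^ k / k ^ k)` in `leRoyWeight`. -/
noncomputable def leRoyPrefactor (n l k : ℕ) (β : ℝ) : ℝ :=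
  (2 * π) ^ ((1 - (k : ℝ)) / 2 - (n : ℝ) * (1 - (l : ℝ)) / 2) * (k : ℝ) ^ (3 / 2 : ℝ) *
    (l : ℝ) ^ (-((n : ℝ) * (β - 1 / 2)))

-- The definition of `gammaList` elaborates with the list of naturals, not its entries, cast to `ℂ`.
lemma gammaList_eq_map (r : ℕ) (t : ℂ) :
    gammaList r t = (List.range r).map fun j : ℕ => (t + j) / r := by
  rw [gammaList]
  change List.map _ (List.flatMap (fun a : ℕ => [(a : ℂ)]) (List.range r)) = _
  rw [← List.map_eq_flatMap, List.map_map]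
  rfl

lemma length_lowerParams (k : ℕ) : (lowerParams k).length = k := by
  simp [lowerParams, gammaList_eq_map]

lemma mem_lowerParams {k : ℕ} {t : ℂ} :
    t ∈ lowerParams k ↔ ∃ j < k, (((1 + j) / k : ℝ) : ℂ) = t := by
  simp [lowerParams, gammaList_eq_map]

lemma prod_map_gammaList (r : ℕ) (t : ℂ) (f : ℂ → ℂ) :
    ((gammaList r t).map f).prod = ∏ j ∈ Finset.range r, f ((t + j) / r) := by
  rw [gammaList_eq_map, List.map_map]
  rfl

lemma prod_Gamma_gammaList {r : ℕ} (hr : 0 < r) (t s : ℂ) :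
    ((gammaList r t).map fun a => Gamma (a + s)).prod =
      (((2 * π) ^ (((r : ℝ) - 1) / 2) * √r : ℝ) : ℂ) * (r : ℂ) ^ (-(r * s + t)) *
        Gamma (r * s + t) := by
  have hr0 : (r : ℂ) ≠ 0 := by exact_mod_cast hr.ne'
  have hmul : (r : ℂ) * (s + t / r) = r * s + t := by field_simp
  rw [prod_map_gammaList, ← hmul, ← prod_Gamma_add_div hr]
  refine Finset.prod_congr rfl fun j _ => ?_
  rw [add_div]
  ring_nf

lemma meijerKernel_leRoy (n : ℕ) {l k : ℕ} (hl : 0 < l) (hk : 0 < k) (β : ℝ) (s : ℂ) :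
    meijerKernel k 0 (upperParams n l β) (lowerParams k) s =
      (((2 * π) ^ (((k : ℝ) - 1) / 2) * √k * ((2 * π) ^ (((l : ℝ) - 1) / 2) * √l)⁻¹ ^ n : ℝ) : ℂ) *
        ((k : ℂ) ^ (-(k * s + 1)) * ((l : ℂ) ^ (-(l * s + β)))⁻¹ ^ n) *
        (Gamma (k * s + 1) * leRoyFactor n (l / k) β (k * s + 1)) := by
  have hk0 : (k : ℂ) ≠ 0 := by exact_mod_cast hk.ne'
  have harg : β + ((l / k : ℝ) : ℂ) * (k * s + 1 - 1) = l * s + β := by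
    push_cast
    field_simp
    ring
  have hlen := (length_lowerParams k).le
  rw [meijerKernel, List.take_of_length_le hlen, List.drop_of_length_le hlen, List.drop_zero,
    List.take_zero, upperParams, lowerParams, List.map_flatten, List.prod_flatten,
    List.map_replicate, List.map_replicate, List.prod_replicate, prod_Gamma_gammaList hk,
    prod_Gamma_gammaList hl, leRoyFactor, harg]
  simp only [List.map_nil, List.prod_nil, mul_one]
  push_cast
  rw [mul_pow, mul_pow, div_eq_mul_inv, mul_inv, mul_inv]
  simp only [inv_pow]
  ring

lemma ofReal_cpow_eq_exp {x : ℝ} (hx : 0 < x) (w : ℂ) : (x : ℂ) ^ w = exp (Real.log x * w) := by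
  rw [cpow_def_of_ne_zero (ofReal_ne_zero.2 hx.ne'), ofReal_log hx.le]

lemma log_pow_mul_pow_div_pow {l k y : ℝ} (hl : 0 < l) (hk : 0 < k) (hy : 0 < y) (p q : ℕ) :
    Real.log (l ^ p * y ^ q / k ^ q) = p * Real.log l + q * Real.log y - q * Real.log k := by
  rw [Real.log_div (by positivity) (by positivity), Real.log_mul (by positivity) (by positivity),
    Real.log_pow, Real.log_pow, Real.log_pow]

lemma cpow_meijerArgument_mul (n : ℕ) {l k : ℕ} (hl : 0 < l) (hk : 0 < k) (β : ℝ) {y : ℝ}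
    (hy : 0 < y) (s : ℂ) :
    (((l : ℝ) ^ (n * l) * y ^ k / (k : ℝ) ^ k : ℝ) : ℂ) ^ (-s) *
        ((k : ℂ) ^ (-(k * s + 1)) * ((l : ℂ) ^ (-(l * s + β)))⁻¹ ^ n) =
      (((k : ℝ)⁻¹ * (l : ℝ) ^ (n * β) * y : ℝ) : ℂ) * (y : ℂ) ^ (-(k * s + 1)) := by
  have hk0 : (0 : ℝ) < k := Nat.cast_pos.2 hk
  have hl0 : (0 : ℝ) < l := Nat.cast_pos.2 hl
  have hconst : (k : ℝ)⁻¹ * (l : ℝ) ^ (n * β) * y =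
      Real.exp (-Real.log k + Real.log l * (n * β) + Real.log y) := by
    rw [Real.exp_add, Real.exp_add, Real.exp_neg, Real.exp_log hk0, Real.exp_log hy,
      ← Real.rpow_def_of_pos hl0]
  rw [← ofReal_natCast k, ← ofReal_natCast l, hconst, ofReal_exp]
  simp only [ofReal_cpow_eq_exp, hk0, hl0, hy,
    show 0 < (l : ℝ) ^ (n * l) * y ^ k / (k : ℝ) ^ k by positivity,
    log_pow_mul_pow_div_pow, ← exp_neg, ← exp_nat_mul, ← exp_add]
  push_cast
  ring_nf

lemma leRoyPrefactor_pos (n : ℕ) {l k : ℕ} (hl : 0 < l) (hk : 0 < k) (β : ℝ) :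
    0 < leRoyPrefactor n l k β := by
  have : (0 : ℝ) < k := Nat.cast_pos.2 hk
  have : (0 : ℝ) < l := Nat.cast_pos.2 hl
  rw [leRoyPrefactor]
  positivity

lemma gaussConstants_eq_div_leRoyPrefactor (n : ℕ) {l k : ℕ} (hl : 0 < l) (hk : 0 < k) (β : ℝ) :
    (2 * π) ^ (((k : ℝ) - 1) / 2) * √k * ((2 * π) ^ (((l : ℝ) - 1) / 2) * √l)⁻¹ ^ n *
      ((k : ℝ)⁻¹ * (l : ℝ) ^ (n * β)) = k / leRoyPrefactor n l k β := by
  have hk0 : (0 : ℝ) < k := Nat.cast_pos.2 hk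
  have hl0 : (0 : ℝ) < l := Nat.cast_pos.2 hl
  have hk1 : (k : ℝ) = (k : ℝ) ^ (1 : ℝ) := (Real.rpow_one _).symm
  have hkinv : (k : ℝ)⁻¹ = (k : ℝ) ^ (-1 : ℝ) := (Real.rpow_neg_one _).symm
  rw [eq_div_iff (leRoyPrefactor_pos n hl hk β).ne', leRoyPrefactor, Real.sqrt_eq_rpow,
    Real.sqrt_eq_rpow, hkinv]
  conv_rhs => rw [hk1]
  simp only [Real.rpow_def_of_pos Real.two_pi_pos, Real.rpow_def_of_pos hk0,
    Real.rpow_def_of_pos hl0, ← Real.exp_add, ← Real.exp_neg, ← Real.exp_nat_mul]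
  ring_nf

lemma cpow_mul_meijerKernel_leRoy (n : ℕ) {l k : ℕ} (hl : 0 < l) (hk : 0 < k) (β : ℝ) {y : ℝ}
    (hy : 0 < y) (s : ℂ) :
    (((l : ℝ) ^ (n * l) * y ^ k / (k : ℝ) ^ k : ℝ) : ℂ) ^ (-s) *
        meijerKernel k 0 (upperParams n l β) (lowerParams k) s =
      ((k / leRoyPrefactor n l k β * y : ℝ) : ℂ) * ((y : ℂ) ^ (-(k * s + 1)) *
        (Gamma (k * s + 1) * leRoyFactor n (l / k) β (k * s + 1))) := by
  rw [meijerKernel_leRoy n hl hk, ← gaussConstants_eq_div_leRoyPrefactor n hl hk]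
  set z : ℝ := (l : ℝ) ^ (n * l) * y ^ k / (k : ℝ) ^ k
  set C : ℝ := (2 * π) ^ (((k : ℝ) - 1) / 2) * √k * ((2 * π) ^ (((l : ℝ) - 1) / 2) * √l)⁻¹ ^ n
  set Φ : ℂ := Gamma (k * s + 1) * leRoyFactor n (l / k) β (k * s + 1)
  calc (z : ℂ) ^ (-s) * (C * ((k : ℂ) ^ (-(k * s + 1)) * ((l : ℂ) ^ (-(l * s + β)))⁻¹ ^ n) * Φ)
      = C * ((z : ℂ) ^ (-s) * ((k : ℂ) ^ (-(k * s + 1)) * ((l : ℂ) ^ (-(l * s + β)))⁻¹ ^ n)) *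
          Φ := by ring
    _ = C * ((((k : ℝ)⁻¹ * (l : ℝ) ^ (n * β) * y : ℝ) : ℂ) * (y : ℂ) ^ (-(k * s + 1))) * Φ := by
        rw [cpow_meijerArgument_mul n hl hk β hy]
    _ = _ := by
        push_cast
        ring

lemma natCast_mul_vertical_add_one (k : ℕ) (c t : ℝ) :
    (k * (c + t * I) + 1 : ℂ) = (k * c + 1 : ℝ) + (k * t : ℝ) * I := by
  push_cast
  ring

lemma mellinInv_meijerKernel_leRoy {n l k : ℕ} (hl : 0 < l) (hk : 0 < k)
    (hnα : n * ((l : ℝ) / k) < 1) (β : ℝ) {c y : ℝ} (hc : 0 < k * c + 1) (hy : 0 < y) :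
    mellinInv c (meijerKernel k 0 (upperParams n l β) (lowerParams k))
        ((l : ℝ) ^ (n * l) * y ^ k / (k : ℝ) ^ k) =
      ((y / leRoyPrefactor n l k β : ℝ) : ℂ) * leRoyDensity n (l / k) β y := by
  have hk0 : (0 : ℝ) < k := Nat.cast_pos.2 hk
  rw [leRoyDensity_eq_mellinInv (by positivity) hnα β hy hc]
  simp only [mellinInv, smul_eq_mul, real_smul]
  simp_rw [cpow_mul_meijerKernel_leRoy n hl hk β hy, natCast_mul_vertical_add_one]
  rw [integral_const_mul, Measure.integral_comp_mul_left
    (fun t : ℝ => (y : ℂ) ^ (-(((k * c + 1 : ℝ) : ℂ) + t * I)) *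
      (Gamma ((k * c + 1 : ℝ) + t * I) * leRoyFactor n (l / k) β ((k * c + 1 : ℝ) + t * I)))
    (k : ℝ), abs_of_pos (inv_pos.2 hk0), real_smul, ← mul_assoc, ← mul_assoc, ← mul_assoc,
    ← ofReal_mul, ← ofReal_mul, ← ofReal_mul]
  congr 2
  field_simp

lemma exists_pos_mul_pow_div_eq {a b z : ℝ} (ha : 0 < a) (hb : 0 < b) {k : ℕ} (hk : k ≠ 0)
    (hz : 0 < z) : ∃ y : ℝ, 0 < y ∧ a * y ^ k / b = z := by
  refine ⟨(z * b / a) ^ ((k : ℝ)⁻¹), by positivity, ?_⟩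
  rw [Real.rpow_inv_natCast_pow (by positivity) hk]
  field_simp

lemma exists_pos_meijerArgument_eq (n : ℕ) {l k : ℕ} (hl : 0 < l) (hk : 0 < k) {z : ℝ}
    (hz : 0 < z) : ∃ y : ℝ, 0 < y ∧ (l : ℝ) ^ (n * l) * y ^ k / (k : ℝ) ^ k = z :=
  exists_pos_mul_pow_div_eq (by positivity) (by positivity) hk.ne' hz

lemma separatesPoles_leRoy_iff (n l : ℕ) {k : ℕ} (hk : 0 < k) (β c : ℝ) :
    SeparatesPoles k 0 (upperParams n l β) (lowerParams k) c ↔ 0 < k * c + 1 := by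
  have hk0 : (0 : ℝ) < k := Nat.cast_pos.2 hk
  simp only [SeparatesPoles, List.take_of_length_le (length_lowerParams k).le, List.take_zero,
    List.not_mem_nil, false_imp_iff, implies_true, and_true, mem_lowerParams]
  refine ⟨fun h => ?_, ?_⟩
  · have h0 := h _ ⟨0, hk, rfl⟩
    rw [ofReal_re, ← neg_div, div_lt_iff₀ hk0, Nat.cast_zero] at h0
    linarith
  · rintro hc _ ⟨j, -, rfl⟩
    have : (0 : ℝ) ≤ j := j.cast_nonneg
    rw [ofReal_re, ← neg_div, div_lt_iff₀ hk0]
    linarith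

lemma verticalIntegrable_meijerKernel_leRoy {n l k : ℕ} (hl : 0 < l) (hk : 0 < k)
    (hnα : n * ((l : ℝ) / k) < 1) (β : ℝ) {c : ℝ} (hc : 0 < k * c + 1) :
    VerticalIntegrable (meijerKernel k 0 (upperParams n l β) (lowerParams k)) c := by
  obtain ⟨y, hy, hy1⟩ := exists_pos_meijerArgument_eq n hl hk one_pos
  have hint := ((verticalIntegrable_cpow_mul_leRoyFactor (by positivity) hnα β hy hc).comp_mul_left'
    (Nat.cast_ne_zero.2 hk.ne' : (k : ℝ) ≠ 0)).const_mul
      ((k / leRoyPrefactor n l k β * y : ℝ) : ℂ)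
  refine hint.congr (.of_forall fun t => ?_)
  have hkernel := cpow_mul_meijerKernel_leRoy n hl hk β hy (c + t * I)
  rw [hy1, ofReal_one, one_cpow, one_mul, natCast_mul_vertical_add_one] at hkernel
  exact hkernel.symm

lemma mellinInv_meijerKernel_leRoy_eq_meijerG {n l k : ℕ} (hl : 0 < l) (hk : 0 < k)
    (hnα : n * ((l : ℝ) / k) < 1) (β : ℝ) {c z : ℝ} (hc : 0 < k * c + 1) (hz : 0 < z) :
    mellinInv c (meijerKernel k 0 (upperParams n l β) (lowerParams k)) z =
      meijerG k 0 (upperParams n l β) (lowerParams k) z := by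
  obtain ⟨y, hy, rfl⟩ := exists_pos_meijerArgument_eq n hl hk hz
  have hline := (separatesPoles_leRoy_iff n l hk β _).1 <| Classical.epsilon_spec
    (p := SeparatesPoles k 0 (upperParams n l β) (lowerParams k))
    ⟨c, (separatesPoles_leRoy_iff n l hk β c).2 hc⟩
  rw [meijerG, mellinInv_meijerKernel_leRoy hl hk hnα β hc hy,
    mellinInv_meijerKernel_leRoy hl hk hnα β hline hy]

lemma leRoyWeight_eq_leRoyDensity {n l k : ℕ} (hl : 0 < l) (hk : 0 < k)
    (hnα : n * ((l : ℝ) / k) < 1) (β : ℝ) {y : ℝ} (hy : 0 < y) :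
    leRoyWeight n l k β y = leRoyDensity n (l / k) β y := by
  have hline : 0 < k * (0 : ℝ) + 1 := by simp
  have hpre := (leRoyPrefactor_pos n hl hk β).ne'
  rw [leRoyWeight, ← leRoyPrefactor,
    ← mellinInv_meijerKernel_leRoy_eq_meijerG hl hk hnα β hline (by positivity),
    mellinInv_meijerKernel_leRoy hl hk hnα β hline hy, ← mul_assoc, ← ofReal_mul,
    mul_assoc, inv_mul_eq_div, div_div_cancel_left' hy.ne', mul_inv_cancel₀ hpre, ofReal_one,
    one_mul]

end MeijerWeight

theorem theorem1 (n l k : ℕ) (hn : 0 < n) (hl : 0 < l) (hk : 0 < k)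
    (hlk : (l : ℝ) / k < 1 / n) (β : ℝ) :
    -- the Mellin-Barnes integral defining the Meijer function converges absolutely, and its value
    -- is the same on all admissible lines
    ((∃ c : ℝ, SeparatesPoles k 0 (upperParams n l β) (lowerParams k) c) ∧
      ∀ c : ℝ, SeparatesPoles k 0 (upperParams n l β) (lowerParams k) c →
        Complex.VerticalIntegrable (meijerKernel k 0 (upperParams n l β) (lowerParams k)) c ∧
        ∀ z : ℝ, 0 < z →
          mellinInv c (meijerKernel k 0 (upperParams n l β) (lowerParams k)) z =
            meijerG k 0 (upperParams n l β) (lowerParams k) z) ∧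
    -- the Laplace transform representation
    (∀ x : ℝ,
      Summable (fun r : ℕ => (-x) ^ r / Real.Gamma (β + (l : ℝ) / k * r) ^ n) ∧
      MeasureTheory.IntegrableOn
        (fun y : ℝ => (Real.exp (-(x * y)) : ℂ) * leRoyWeight n l k β y) (Set.Ioi 0) ∧
      (mittagLefflerLeRoy n ((l : ℝ) / k) β (-x) : ℂ) =
        ∫ y in Set.Ioi (0 : ℝ), (Real.exp (-(x * y)) : ℂ) * leRoyWeight n l k β y) ∧
    -- the power series, with infinite radius of convergence
    (FormalMultilinearSeries.ofScalars ℝ (leRoyCoeff n l k β)).radius = ⊤ ∧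
    (∀ y : ℝ, 0 < y →
      HasSum (fun r : ℕ => ((leRoyCoeff n l k β r * y ^ r : ℝ) : ℂ)) (leRoyWeight n l k β y)) ∧
    -- the exponential bound
    (∃ A a : ℝ, ∀ y : ℝ, 0 < y → ‖leRoyWeight n l k β y‖ ≤ A * Real.exp (a * y)) := by
  have hn0 : (0 : ℝ) < n := Nat.cast_pos.2 hn
  have hα : 0 < (l : ℝ) / k := div_pos (Nat.cast_pos.2 hl) (Nat.cast_pos.2 hk)
  have hnα : n * ((l : ℝ) / k) < 1 := (lt_div_iff₀' hn0).1 hlk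
  have hweight : Set.EqOn (leRoyWeight n l k β) (leRoyDensity n (l / k) β) (Set.Ioi 0) :=
    fun _ => leRoyWeight_eq_leRoyDensity hl hk hnα β
  refine ⟨⟨⟨0, (separatesPoles_leRoy_iff n l hk β 0).2 (by simp)⟩, fun c hc => ?_⟩,
    fun x => ⟨summable_pow_div_Gamma_pow hn hα β (-x), ?_, ?_⟩,
    radius_ofScalars_leRoyTaylor hα hnα β, fun y hy => ?_, ?_⟩
  · rw [separatesPoles_leRoy_iff n l hk] at hc
    exact ⟨verticalIntegrable_meijerKernel_leRoy hl hk hnα β hc,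
      fun z hz => mellinInv_meijerKernel_leRoy_eq_meijerG hl hk hnα β hc hz⟩
  · exact (integrableOn_exp_neg_mul_leRoyDensity hn hα hnα β x).congr_fun
      (fun y hy => congrArg (_ * ·) (hweight hy).symm) measurableSet_Ioi
  · rw [mittagLefflerLeRoy_eq_laplace hn hα hnα]
    exact MeasureTheory.setIntegral_congr_fun measurableSet_Ioi
      fun y hy => congrArg (_ * ·) (hweight hy).symm
  · rw [hweight hy]
    exact_mod_cast hasSum_leRoyDensity hα hnα β hy
  · obtain ⟨C, hC⟩ := exists_norm_leRoyDensity_le hn hα hnα β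
    exact ⟨C, 0, fun y hy => by simpa [hweight hy] using hC y hy⟩
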